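/- Let $\mathbb N=\{1,2,\dots\}$. Let $X\subseteq\{1,\dots,d\}^{\mathbb N}$ be a non-empty one-sided subshift, i.e. a closed set with $\sigma(X)\subseteq X$ for the shift $(\sigma x)_i=x_{i+1}$; write $\sigma_X=\sigma|_X$. Let $B_n(X)$ be the set of words of length $n$ occurring in points of $X$, $B(X)=\bigcup_{n\ge 0}B_n(X)$, and for $u\in B_n(X)$ let $[u]=\{x\in X: x_1\cdots x_n=u\}$. For $u\in B(X)$ and $n\in\mathbb N$ put $F_n(u)=\{v\in B_n(X): uv\in B(X)\}$ and $P_n(u)=\{v\in B_n(X): vu\in B(X)\}$. Assume that $X$ has the strong specification property with specification number $k\in\mathbb N$: for all $u,v\in B(X)$ there is $w\in B_k(X)$ with $uwv\in B(X)$. Let $\mathcal F=\{\log f_n\}_{n\in\mathbb N}$ with $f_n:X\to(0,\infty)$ continuous, and assume that $\mathcal F$ is superadditive: there is $C\ge 0$ with $f_{m+n}(x)\ge e^{-C}f_m(x)f_n(\sigma_X^m x)$ for all $x\in X$ and $m,n\in\mathbb N$. Definitions. - $X$ is right balanced with respect to $\mathcal F$ if there are $C\ge1$ and $K\in\mathbb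 N$ such that for all $m\in\mathbb N$, $n\ge K$, $u\in B_m(X)$ and every choice of points $x_u\in[u]$, $x_{uv}\in[uv]$, $x_w\in[w]$, $$\frac1C\le\frac{\sum_{v\in F_n(u)}f_{m+n}(x_{uv})}{f_m(x_u)\sum_{w\in B_n(X)}f_n(x_w)}\le C;$$ left balanced is defined in the same way with $\sum_{v\in P_n(u)}f_{m+n}(x_{vu})$, $x_{vu}\in[vu]$, in the numerator; balanced means both right and left balanced. - $\mathcal F$ has bounded variation if there is $M\ge1$ such that $f_n(x)/f_n(y)\le M$ for all $n\in\mathbb N$ and all $x,y\in X$ with $x_i=y_i$ for $1\le i\le n$. - A Borel probability measure $\mu$ on $X$ is Gibbs for $\mathcal F$ if there are $P\in\mathbb R$ and $C>0$ with $\frac1C\le\frac{\mu([u])}{e^{-nP}f_n(x)}\le C$ for all $n\in\mathbb N$, $u\in B_n(X)$, $x\in[u]$. - $P(\mathcal F)=\limsup_{n\to\infty}\frac1n\log\sum_{u\in B_n(X)}\sup_{x\in[u]}f_n(x)$; $M(X,\sigma_X)$ is the set of $\sigma_X$-invariant Borel probability measures on $X$; $h_\mu(\sigma_X)$ is the Kolmogorov–Sinai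 entropy. A measure $\mu\in M(X,\sigma_X)$ is an equilibrium state for $\mathcal F$ if $h_\mu(\sigma_X)+\lim_n\frac1n\int\log f_n\,d\mu=\sup_{m\in M(X,\sigma_X)}\{h_m(\sigma_X)+\lim_n\frac1n\int\log f_n\,dm\}$. Then: (i) $X$ is right balanced with respect to $\mathcal F$ if and only if $\mathcal F$ has bounded variation and (sup1) there is $C_1\ge1$ such that for all $n,m\in\mathbb N$, $u\in B_m(X)$ and every choice of $x_{uv}\in[uv]$, $x_u\in[u]$, $x_v\in[v]$, $$\sum_{v\in F_{n+k}(u)}f_{m+n+k}(x_{uv})\le C_1f_m(x_u)\sum_{v\in B_n(X)}f_n(x_v).$$ (ii) $X$ is left balanced with respect to $\mathcal F$ if and only if $\mathcal F$ has bounded variation and (sup2) there is $C_1\ge1$ such that for all $n,m\in\mathbb N$, $u\in B_m(X)$ and every choice of $x_{vu}\in[vu]$, $x_u\in[u]$, $x_v\in[v]$, $$\sum_{v\in P_{n+k}(u)}f_{m+n+k}(x_{vu})\le C_1f_m(x_u)\sum_{v\in B_n(X)}f_n(x_v).$$ (iii) $X$ is balanced with respect to $\mathcal F$ if and only if $\mathcal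 F$ has bounded variation and both (sup1) and (sup2) hold. (iv) $X$ is balanced with respect to $\mathcal F$ if and only if there exists a unique invariant ergodic Gibbs measure for $\mathcal F$. (v) If $X$ is balanced with respect to $\mathcal F$, then $\lim_n\frac1n\int\log f_n\,d\mu$ exists in $\mathbb R$ for every $\mu\in M(X,\sigma_X)$, the variational principle $$P(\mathcal F)=\sup_{\mu\in M(X,\sigma_X)}\Big\{h_\mu(\sigma_X)+\lim_{n\to\infty}\frac1n\int\log f_n\,d\mu\Big\}$$ holds, and the unique invariant ergodic Gibbs measure for $\mathcal F$ is an equilibrium state for $\mathcal F$. -/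

import Mathlib

open MeasureTheory Filter Topology
open scoped BigOperators

noncomputable section

namespace ShiftGibbs

/-- A one-sided subshift over the alphabet `{0, …, d - 1}`: a closed subset `X` of
`ℕ → Fin d` (product topology) with `σ(X) ⊆ X`. -/
abbrev OneSidedSubshift (d : ℕ) : Type := SymbolicDynamics.FullShift.Subshift (Fin d) ℕ

variable {d : ℕ}

/-- The points of the subshift, with the subspace topology and the Borel σ-algebra
(the trace of the product σ-algebra). -/
abbrev Pt (X : OneSidedSubshift d) : Type := ↥X.carrier

/-- The shift map `σ_X : X → X`, `(σ_X x)_i = x_{i+1}`. -/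
def shiftMap (X : OneSidedSubshift d) (x : Pt X) : Pt X :=
  ⟨SymbolicDynamics.FullShift.shift 1 x.1, X.mapsTo 1 x.2⟩

theorem shiftMap_apply (X : OneSidedSubshift d) (x : Pt X) (i : ℕ) :
    (shiftMap X x).1 i = x.1 (i + 1) := by
  simp [shiftMap, add_comm]

/-- The cylinder `[u] ⊆ X` of a word `u` of length `n`. -/
def cyl (X : OneSidedSubshift d) {n : ℕ} (u : Fin n → Fin d) : Set (Pt X) :=
  {x | ∀ i : Fin n, x.1 i = u i}

open Classical in
/-- The set `B_n(X)` of allowable words of length `n`, that is, of the words of length `n`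
occurring in a point of `X`. As `σ(X) ⊆ X`, these are the words at the start of a point of `X`. -/
def words (X : OneSidedSubshift d) (n : ℕ) : Finset (Fin n → Fin d) :=
  Finset.univ.filter fun u => (cyl X u).Nonempty

theorem mem_words_iff_occurs (X : OneSidedSubshift d) {n : ℕ} (u : Fin n → Fin d) :
    u ∈ words X n ↔ ∃ x : Pt X, ∃ j : ℕ, ∀ i : Fin n, x.1 (j + i) = u i := by
  simp only [words, Finset.mem_filter, Finset.mem_univ, true_and]
  constructor
  · rintro ⟨x, hx⟩
    exact ⟨x, 0, fun i => by simpa using hx i⟩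
  · rintro ⟨x, j, hx⟩
    exact ⟨⟨SymbolicDynamics.FullShift.shift j x.1, X.mapsTo j x.2⟩, fun i => by simpa using hx i⟩

open Classical in
/-- `F_n(u)`: the words `v ∈ B_n(X)` such that `uv` is allowable. -/
def followers (X : OneSidedSubshift d) {m : ℕ} (u : Fin m → Fin d) (n : ℕ) :
    Finset (Fin n → Fin d) :=
  (words X n).filter fun v => Fin.append u v ∈ words X (m + n)

open Classical in
/-- `P_n(u)`: the words `v ∈ B_n(X)` such that `vu` is allowable. -/
def predecessors (X : OneSidedSubshift d) {m : ℕ} (u : Fin m → Fin d) (n : ℕ) :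
    Finset (Fin n → Fin d) :=
  (words X n).filter fun v => Fin.append v u ∈ words X (n + m)

/-- `X` has the strong specification property with specification number `k ≥ 1`: any two allowable
words `u, v` can be joined to an allowable word `uwv` by some `w ∈ B_k(X)`. -/
def HasStrongSpecification (X : OneSidedSubshift d) (k : ℕ) : Prop :=
  1 ≤ k ∧ ∀ (m n : ℕ), ∀ u ∈ words X m, ∀ v ∈ words X n,
    ∃ w ∈ words X k, Fin.append (Fin.append u w) v ∈ words X (m + k + n)

/-! A sequence `F = {log f_n}_{n ≥ 1}` of continuous functions is given by `f : ℕ → Pt X → ℝ` with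
`f n` continuous and positive for `n ≥ 1`; the value `f 0` plays no role. -/

/-- `F = {log f_n}_{n ≥ 1}` is a sequence of continuous real functions on `X`. -/
def IsContinuousSequence (X : OneSidedSubshift d) (f : ℕ → Pt X → ℝ) : Prop :=
  ∀ n, 1 ≤ n → Continuous (f n) ∧ ∀ x, 0 < f n x

/-- Superadditivity of `F`: `f_{m+n}(x) ≥ e^{-C} f_m(x) f_n(σ^m x)`. -/
def IsSuperadditive (X : OneSidedSubshift d) (f : ℕ → Pt X → ℝ) : Prop :=
  ∃ C : ℝ, 0 ≤ C ∧ ∀ m n, 1 ≤ m → 1 ≤ n → ∀ x : Pt X,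
    Real.exp (-C) * f m x * f n ((shiftMap X)^[m] x) ≤ f (m + n) x

/-- Bounded variation of `F`. -/
def HasBoundedVariation (X : OneSidedSubshift d) (f : ℕ → Pt X → ℝ) : Prop :=
  ∃ M : ℝ, 1 ≤ M ∧ ∀ n, 1 ≤ n → ∀ x y : Pt X, (∀ i < n, x.1 i = y.1 i) → f n x / f n y ≤ M

/-- `X` is right balanced with respect to `F`. The functions `y` and `z` are arbitrary choices of
points `x_{uv} ∈ [uv]` for `v ∈ F_n(u)`, and `x_w ∈ [w]` for `w ∈ B_n(X)`. -/
def RightBalanced (X : OneSidedSubshift d) (f : ℕ → Pt X → ℝ) : Prop :=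
  ∃ C : ℝ, 1 ≤ C ∧ ∃ K : ℕ, 1 ≤ K ∧ ∀ m n, 1 ≤ m → K ≤ n → ∀ u ∈ words X m,
    ∀ x ∈ cyl X u,
    ∀ y : (Fin n → Fin d) → Pt X, (∀ v ∈ followers X u n, y v ∈ cyl X (Fin.append u v)) →
    ∀ z : (Fin n → Fin d) → Pt X, (∀ w ∈ words X n, z w ∈ cyl X w) →
      1 / C ≤ (∑ v ∈ followers X u n, f (m + n) (y v)) / (f m x * ∑ w ∈ words X n, f n (z w)) ∧
      (∑ v ∈ followers X u n, f (m + n) (y v)) / (f m x * ∑ w ∈ words X n, f n (z w)) ≤ C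

/-- `X` is left balanced with respect to `F`. -/
def LeftBalanced (X : OneSidedSubshift d) (f : ℕ → Pt X → ℝ) : Prop :=
  ∃ C : ℝ, 1 ≤ C ∧ ∃ K : ℕ, 1 ≤ K ∧ ∀ m n, 1 ≤ m → K ≤ n → ∀ u ∈ words X m,
    ∀ x ∈ cyl X u,
    ∀ y : (Fin n → Fin d) → Pt X, (∀ v ∈ predecessors X u n, y v ∈ cyl X (Fin.append v u)) →
    ∀ z : (Fin n → Fin d) → Pt X, (∀ w ∈ words X n, z w ∈ cyl X w) →
      1 / C ≤ (∑ v ∈ predecessors X u n, f (m + n) (y v)) /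
        (f m x * ∑ w ∈ words X n, f n (z w)) ∧
      (∑ v ∈ predecessors X u n, f (m + n) (y v)) /
        (f m x * ∑ w ∈ words X n, f n (z w)) ≤ C

/-- `X` is balanced with respect to `F`. -/
def Balanced (X : OneSidedSubshift d) (f : ℕ → Pt X → ℝ) : Prop :=
  RightBalanced X f ∧ LeftBalanced X f

/-- The upper inequality
`∑_{v ∈ F_{n+k}(u)} f_{m+n+k}(x_{uv}) ≤ C₁ f_m(x_u) ∑_{v ∈ B_n(X)} f_n(x_v)`. -/
def RightUpperInequality (X : OneSidedSubshift d) (f : ℕ → Pt X → ℝ) (k : ℕ) : Prop :=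
  ∃ C₁ : ℝ, 1 ≤ C₁ ∧ ∀ m n, 1 ≤ m → 1 ≤ n → ∀ u ∈ words X m,
    ∀ x ∈ cyl X u,
    ∀ y : (Fin (n + k) → Fin d) → Pt X,
      (∀ v ∈ followers X u (n + k), y v ∈ cyl X (Fin.append u v)) →
    ∀ z : (Fin n → Fin d) → Pt X, (∀ v ∈ words X n, z v ∈ cyl X v) →
      ∑ v ∈ followers X u (n + k), f (m + n + k) (y v) ≤
        C₁ * f m x * ∑ v ∈ words X n, f n (z v)

/-- The upper inequality
`∑_{v ∈ P_{n+k}(u)} f_{m+n+k}(x_{vu}) ≤ C₁ f_m(x_u) ∑_{v ∈ B_n(X)} f_n(x_v)`. -/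
def LeftUpperInequality (X : OneSidedSubshift d) (f : ℕ → Pt X → ℝ) (k : ℕ) : Prop :=
  ∃ C₁ : ℝ, 1 ≤ C₁ ∧ ∀ m n, 1 ≤ m → 1 ≤ n → ∀ u ∈ words X m,
    ∀ x ∈ cyl X u,
    ∀ y : (Fin (n + k) → Fin d) → Pt X,
      (∀ v ∈ predecessors X u (n + k), y v ∈ cyl X (Fin.append v u)) →
    ∀ z : (Fin n → Fin d) → Pt X, (∀ v ∈ words X n, z v ∈ cyl X v) →
      ∑ v ∈ predecessors X u (n + k), f (m + n + k) (y v) ≤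
        C₁ * f m x * ∑ v ∈ words X n, f n (z v)

/-- A Borel probability measure `μ` on `X` is a Gibbs measure for `F`. -/
def IsGibbs (X : OneSidedSubshift d) (f : ℕ → Pt X → ℝ) (μ : Measure (Pt X)) : Prop :=
  IsProbabilityMeasure μ ∧
  ∃ P : ℝ, ∃ C : ℝ, 0 < C ∧ ∀ n, 1 ≤ n → ∀ u ∈ words X n, ∀ x ∈ cyl X u,
    1 / C ≤ μ.real (cyl X u) / (Real.exp (-(n * P)) * f n x) ∧
    μ.real (cyl X u) / (Real.exp (-(n * P)) * f n x) ≤ C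

/-- An invariant ergodic Gibbs measure for `F` (Mathlib's `Ergodic` includes invariance). -/
def IsErgodicGibbs (X : OneSidedSubshift d) (f : ℕ → Pt X → ℝ) (μ : Measure (Pt X)) : Prop :=
  IsGibbs X f μ ∧ Ergodic (shiftMap X) μ

/-- `M(X, σ_X)`: the invariant Borel probability measures on `X`. -/
def invariantMeasures (X : OneSidedSubshift d) : Set (Measure (Pt X)) :=
  {μ | IsProbabilityMeasure μ ∧ MeasurePreserving (shiftMap X) μ μ}

/-- `Z_n(F) = ∑_{u ∈ B_n(X)} sup {f_n(x) : x ∈ [u]}`. -/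
def partitionSum (X : OneSidedSubshift d) (f : ℕ → Pt X → ℝ) (n : ℕ) : ℝ :=
  ∑ u ∈ words X n, sSup (f n '' cyl X u)

/-- The topological pressure `P(F) = limsup (1/n) log Z_n(F)`, in `[-∞, ∞]`. -/
def pressure (X : OneSidedSubshift d) (f : ℕ → Pt X → ℝ) : EReal :=
  limsup (fun n : ℕ => ((1 / (n : ℝ) * Real.log (partitionSum X f n) : ℝ) : EReal)) atTop

section Entropy

variable {Ω : Type*} [MeasurableSpace Ω]

/-- The Shannon entropy `-∑ μ(A) log μ(A)` of the finite partition of `Ω` into the level sets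
of `ξ`. -/
def shannonEntropy (μ : Measure Ω) {ι : Type*} [Fintype ι] (ξ : Ω → ι) : ℝ :=
  ∑ a, Real.negMulLog (μ.real (ξ ⁻¹' {a}))

/-- The map whose level sets form the join of `T^{-i} ξ`, `0 ≤ i < n`. -/
def itinerary (T : Ω → Ω) {r : ℕ} (ξ : Ω → Fin r) (n : ℕ) (x : Ω) : Fin n → Fin r :=
  fun i => ξ (T^[i] x)

/-- The entropy `h_μ(T, ξ) = lim (1/n) H_μ(ξ ∨ T^{-1} ξ ∨ … ∨ T^{-(n-1)} ξ)` of `T` relative to a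
finite partition. (For invariant `μ` the limit exists, so it is the upper limit.) -/
def entropyOfPartition (T : Ω → Ω) (μ : Measure Ω) {r : ℕ} (ξ : Ω → Fin r) : EReal :=
  limsup (fun n : ℕ => ((1 / (n : ℝ) * shannonEntropy μ (itinerary T ξ n) : ℝ) : EReal)) atTop

/-- The Kolmogorov–Sinai entropy `h_μ(T)`: the supremum of `h_μ(T, ξ)` over all finite measurable
partitions `ξ`. -/
def ksEntropy (T : Ω → Ω) (μ : Measure Ω) : EReal :=
  ⨆ (r : ℕ) (ξ : Ω → Fin r) (_ : Measurable ξ), entropyOfPartition T μ ξ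

end Entropy

/-- `lim (1/n) ∫ log f_n dμ` exists and equals `L`. -/
def HasAsymptoticAverage (X : OneSidedSubshift d) (f : ℕ → Pt X → ℝ) (μ : Measure (Pt X))
    (L : EReal) : Prop :=
  Tendsto (fun n : ℕ => ((1 / (n : ℝ) * ∫ x, Real.log (f n x) ∂μ : ℝ) : EReal)) atTop (𝓝 L)

/-- The set of the values `h_μ(σ_X) + lim (1/n) ∫ log f_n dμ`, `μ ∈ M(X, σ_X)`. -/
def freeEnergies (X : OneSidedSubshift d) (f : ℕ → Pt X → ℝ) : Set EReal :=
  {e | ∃ μ ∈ invariantMeasures X, ∃ L : EReal, HasAsymptoticAverage X f μ L ∧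
    e = ksEntropy (shiftMap X) μ + L}

/-- `μ ∈ M(X, σ_X)` is an equilibrium state for `F`:
`h_μ(σ_X) + lim (1/n) ∫ log f_n dμ = sup_m (h_m(σ_X) + lim (1/n) ∫ log f_n dm)`. -/
def IsEquilibriumState (X : OneSidedSubshift d) (f : ℕ → Pt X → ℝ) (μ : Measure (Pt X)) : Prop :=
  μ ∈ invariantMeasures X ∧ ∃ L : EReal, HasAsymptoticAverage X f μ L ∧
    ksEntropy (shiftMap X) μ + L = sSup (freeEnergies X f)

end ShiftGibbs

end

/-!
The values of `f_n` are replaced by one weight per word, and every assertion becomes a statement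
about three sums of weights: `weightSum f n = ∑_{u ∈ B_n} w(u)`, and the sums `rightSum f u n`,
`leftSum f u n` of the weights of the words `uv`, `vu` with `v` of length `n`. Bounded variation
says that the choice of points does not matter; it follows from balance on either side, because the
other terms in the balance condition do not involve the point `x_u`.

*Balance and the upper inequality.* Both families of extension sums have the properties collected in
`ExtensionSum`: they add up to `weightSum`; `w(u)`, and the sum for a shorter extension, is at most
a constant times the sum for a longer one (superadditivity); and they satisfy the lower bound
`w(u) * weightSum n ≤ D * S u (n + k)`, from specification and superadditivity. From these and the
positivity of the weights, balance and the upper inequality are equivalent, and balance for long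
extensions is balance for all.

*Gibbs measures.* Under balance `weightSum` is almost multiplicative, hence comparable with `e^{nP}`
(`exists_abs_sub_mul_le`). Put masses proportional to the weights at one point of each cylinder of
length `2N`, and average the images under `σ, …, σ^N`. Right balance gives the Gibbs inequalities
for the atomic measures, left balance carries them over to the images, and a weak limit is an
invariant Gibbs measure (`exists_invariant_gibbsBound`). Connecting words of length `k` give
`μ[u] μ[v] ≤ D μ([u] ∩ σ^{-(m+k)}[v])`, which extends to finite unions of cylinders and forces
ergodicity by approximation (`GibbsBound.ergodic`). Two ergodic Gibbs measures have the same
exponent, so one is absolutely continuous with respect to the other, and they agree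
(`IsErgodicGibbs.unique`). Conversely, the measure of `[u]` is the sum of the measures of the
`[uv]`, and by invariance of the `[vu]`, so an invariant Gibbs measure forces balance
(`IsErgodicGibbs.balanced`).

*Variational principle.* The upper bound for the entropy with respect to an arbitrary finite
partition comes from a single application of the Gibbs inequality, to a code for itineraries: a
word of length `n + N` costs minus the logarithm of its share of `weightSum`, and given the word each
letter of the itinerary costs little, as the partition is approximated by one into cylinders of
length `N` (`exists_shannonEntropy_itinerary_le`). This replaces the Kolmogorov–Sinai generator
theorem. For the Gibbs measure the partition into cylinders of length `1` attains the bound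
(`GibbsBound.le_ksEntropy`).
-/

noncomputable section

namespace ShiftGibbs

section

variable {d : ℕ} {X : OneSidedSubshift d}

/-! ### Words, cylinders and the shift -/

/-- The word `x_1 ⋯ x_n` at the start of the point `x`. -/
def prefixWord (n : ℕ) (x : Pt X) : Fin n → Fin d := fun i => x.1 i

theorem mem_cyl_iff {n : ℕ} {u : Fin n → Fin d} {x : Pt X} :
    x ∈ cyl X u ↔ prefixWord n x = u :=
  funext_iff.symm

theorem mem_words_iff {n : ℕ} {u : Fin n → Fin d} :
    u ∈ words X n ↔ ∃ x : Pt X, prefixWord n x = u := by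
  simp only [words, Finset.mem_filter, Finset.mem_univ, true_and]
  exact exists_congr fun x => mem_cyl_iff

theorem prefixWord_mem_words (n : ℕ) (x : Pt X) : prefixWord n x ∈ words X n :=
  mem_words_iff.2 ⟨x, rfl⟩

theorem shiftMap_iterate_apply (m : ℕ) (x : Pt X) (i : ℕ) :
    ((shiftMap X)^[m] x).1 i = x.1 (m + i) := by
  induction m generalizing x with
  | zero => simp
  | succ m ih => rw [Function.iterate_succ_apply, ih, shiftMap_apply, Nat.add_right_comm]

theorem append_prefixWord (m n : ℕ) (x : Pt X) :
    Fin.append (prefixWord m x) (prefixWord n ((shiftMap X)^[m] x)) = prefixWord (m + n) x := by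
  ext i
  refine Fin.addCases (fun i => ?_) (fun i => ?_) i <;>
    simp [prefixWord, shiftMap_iterate_apply]

theorem append_eq_iff {m n : ℕ} {u u' : Fin m → Fin d} {v v' : Fin n → Fin d} :
    Fin.append u v = Fin.append u' v' ↔ u = u' ∧ v = v' := by
  have h := (Fin.appendEquiv (α := Fin d) m n).injective.eq_iff (a := (u, v)) (b := (u', v'))
  simpa [Fin.appendEquiv] using h

theorem prefixWord_add_eq_append_iff {m n : ℕ} {u : Fin m → Fin d} {v : Fin n → Fin d}
    {x : Pt X} :
    prefixWord (m + n) x = Fin.append u v ↔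
      prefixWord m x = u ∧ prefixWord n ((shiftMap X)^[m] x) = v := by
  rw [← append_prefixWord, append_eq_iff]

theorem prefixWord_eq_of_le {m n : ℕ} (h : m ≤ n) {x y : Pt X}
    (hxy : prefixWord n x = prefixWord n y) : prefixWord m x = prefixWord m y := by
  funext i
  exact congrFun hxy ⟨i, i.2.trans_le h⟩

theorem mem_followers_iff {m n : ℕ} {u : Fin m → Fin d} {v : Fin n → Fin d} :
    v ∈ followers X u n ↔ Fin.append u v ∈ words X (m + n) := by
  simp only [followers, Finset.mem_filter, and_iff_right_iff_imp]
  intro h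
  obtain ⟨x, hx⟩ := mem_words_iff.1 h
  rw [prefixWord_add_eq_append_iff] at hx
  exact hx.2 ▸ prefixWord_mem_words _ _

theorem mem_predecessors_iff {m n : ℕ} {u : Fin m → Fin d} {v : Fin n → Fin d} :
    v ∈ predecessors X u n ↔ Fin.append v u ∈ words X (n + m) := by
  simp only [predecessors, Finset.mem_filter, and_iff_right_iff_imp]
  intro h
  obtain ⟨x, hx⟩ := mem_words_iff.1 h
  rw [prefixWord_add_eq_append_iff] at hx
  exact hx.1 ▸ prefixWord_mem_words _ _

theorem sum_words_add (m n : ℕ) (g : (Fin (m + n) → Fin d) → ℝ) :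
    ∑ w ∈ words X (m + n), g w =
      ∑ u : Fin m → Fin d, ∑ v : Fin n → Fin d,
        if Fin.append u v ∈ words X (m + n) then g (Fin.append u v) else 0 := by
  rw [← Fintype.sum_prod_type' (f := fun u v =>
    if Fin.append u v ∈ words X (m + n) then g (Fin.append u v) else 0),
    ← Finset.sum_filter_of_ne (p := fun w => w ∈ words X (m + n)) (fun x hx _ => hx),
    Finset.sum_filter]
  have : ∀ w ∈ (Finset.univ : Finset (Fin (m + n) → Fin d)), w ∉ words X (m + n) →
      (if w ∈ words X (m + n) then g w else 0) = 0 := fun w _ h => if_neg h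
  rw [Finset.sum_subset (Finset.subset_univ _) this]
  exact (Fintype.sum_equiv (Fin.appendEquiv m n) _ _ fun p => by rfl).symm

theorem sum_followers (m n : ℕ) (g : (Fin (m + n) → Fin d) → ℝ) :
    ∑ u ∈ words X m, ∑ v ∈ followers X u n, g (Fin.append u v) =
      ∑ w ∈ words X (m + n), g w := by
  rw [sum_words_add]
  have h1 : ∀ u : Fin m → Fin d, ∑ v ∈ followers X u n, g (Fin.append u v) =
      ∑ v : Fin n → Fin d,
        if Fin.append u v ∈ words X (m + n) then g (Fin.append u v) else 0 := by
    intro u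
    rw [← Finset.sum_filter]
    congr 1
    ext v
    simp [mem_followers_iff]
  simp_rw [h1]
  refine Finset.sum_subset (Finset.subset_univ _) fun u _ hu => ?_
  refine Finset.sum_eq_zero fun v _ => if_neg fun h => hu ?_
  obtain ⟨x, hx⟩ := mem_words_iff.1 h
  rw [prefixWord_add_eq_append_iff] at hx
  exact hx.1 ▸ prefixWord_mem_words _ _

theorem sum_predecessors (m n : ℕ) (g : (Fin (n + m) → Fin d) → ℝ) :
    ∑ u ∈ words X m, ∑ v ∈ predecessors X u n, g (Fin.append v u) =
      ∑ w ∈ words X (n + m), g w := by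
  rw [sum_words_add, Finset.sum_comm]
  have h1 : ∀ u : Fin m → Fin d, ∑ v ∈ predecessors X u n, g (Fin.append v u) =
      ∑ v : Fin n → Fin d,
        if Fin.append v u ∈ words X (n + m) then g (Fin.append v u) else 0 := by
    intro u
    rw [← Finset.sum_filter]
    congr 1
    ext v
    simp [mem_predecessors_iff]
  simp_rw [h1]
  refine Finset.sum_subset (Finset.subset_univ _) fun u _ hu => ?_
  refine Finset.sum_eq_zero fun v _ => if_neg fun h => hu ?_
  obtain ⟨x, hx⟩ := mem_words_iff.1 h
  rw [prefixWord_add_eq_append_iff] at hx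
  exact hx.2 ▸ prefixWord_mem_words _ _

theorem continuous_shiftMap : Continuous (shiftMap X) := by
  refine Continuous.subtype_mk (continuous_pi fun i => ?_) _
  exact (continuous_apply (1 + i)).comp continuous_subtype_val

theorem continuous_prefixWord (n : ℕ) : Continuous (prefixWord (X := X) n) :=
  continuous_pi fun i => (continuous_apply (i : ℕ)).comp continuous_subtype_val

theorem measurable_prefixWord (n : ℕ) : Measurable (prefixWord (X := X) n) :=
  (continuous_prefixWord n).measurable

theorem cyl_eq_preimage {n : ℕ} (u : Fin n → Fin d) : cyl X u = prefixWord n ⁻¹' {u} := by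
  ext x
  simp [mem_cyl_iff]

theorem measurableSet_cyl {n : ℕ} (u : Fin n → Fin d) : MeasurableSet (cyl X u) :=
  cyl_eq_preimage u ▸ measurable_prefixWord n (measurableSet_singleton u)

instance : CompactSpace (Pt X) := isCompact_iff_compactSpace.1 X.isClosed.isCompact

/-! ### Strong specification -/

/-- Under strong specification, some point starts with `u`, followed by `k` letters and then `v`,
for any allowable words `u` and `v`. -/
theorem HasStrongSpecification.exists_point {k : ℕ} (hk : HasStrongSpecification X k) {m n : ℕ}
    {u : Fin m → Fin d} (hu : u ∈ words X m) {v : Fin n → Fin d} (hv : v ∈ words X n) :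
    ∃ x : Pt X, prefixWord m x = u ∧ prefixWord n ((shiftMap X)^[m + k] x) = v := by
  obtain ⟨w, -, hw⟩ := hk.2 m n u hu v hv
  obtain ⟨x, hx⟩ := mem_words_iff.1 hw
  rw [prefixWord_add_eq_append_iff, prefixWord_add_eq_append_iff] at hx
  exact ⟨x, hx.1.1, hx.2⟩

/-- Under strong specification, every allowable word can be extended to the left by any number
of letters. -/
theorem HasStrongSpecification.exists_preimage {k : ℕ} (hk : HasStrongSpecification X k) {n : ℕ}
    {v : Fin n → Fin d} (hv : v ∈ words X n) (j : ℕ) :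
    ∃ x : Pt X, prefixWord n ((shiftMap X)^[j] x) = v := by
  obtain ⟨y, -⟩ := mem_words_iff.1 hv
  obtain ⟨x, -, hx⟩ := hk.exists_point (prefixWord_mem_words j y) hv
  refine ⟨(shiftMap X)^[k] x, ?_⟩
  rwa [← Function.iterate_add_apply]

/-! ### Weights of words -/

/-- Comparison of sums along an injection of the index sets. -/
theorem sum_le_mul_sum_of_injOn {ι κ : Type*} {s : Finset ι} {t : Finset κ} {a : ι → ℝ}
    {b : κ → ℝ} {C : ℝ} (φ : ι → κ) (hφ : ∀ i ∈ s, φ i ∈ t) (hinj : Set.InjOn φ s)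
    (hb : ∀ j ∈ t, 0 ≤ b j) (hC : 0 ≤ C) (h : ∀ i ∈ s, a i ≤ C * b (φ i)) :
    ∑ i ∈ s, a i ≤ C * ∑ j ∈ t, b j := by
  classical
  calc ∑ i ∈ s, a i ≤ ∑ i ∈ s, C * b (φ i) := Finset.sum_le_sum h
    _ = C * ∑ j ∈ s.image φ, b j := by rw [← Finset.mul_sum, Finset.sum_image hinj]
    _ ≤ C * ∑ j ∈ t, b j := by
      refine mul_le_mul_of_nonneg_left (Finset.sum_le_sum_of_subset_of_nonneg ?_ ?_) hC
      · exact Finset.image_subset_iff.2 hφ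
      · exact fun j hj _ => hb j hj

variable {f : ℕ → Pt X → ℝ}

theorem IsContinuousSequence.bddAbove (hf : IsContinuousSequence X f) {n : ℕ} (hn : 1 ≤ n)
    (s : Set (Pt X)) : BddAbove (f n '' s) :=
  (isCompact_univ.image (hf n hn).1).bddAbove.mono (Set.image_mono (Set.subset_univ s))

theorem HasBoundedVariation.exists_bound (hf : IsContinuousSequence X f)
    (hbv : HasBoundedVariation X f) :
    ∃ M : ℝ, 1 ≤ M ∧ ∀ n, 1 ≤ n → ∀ x y : Pt X, prefixWord n x = prefixWord n y →
      f n x ≤ M * f n y := by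
  obtain ⟨M, hM, h⟩ := hbv
  refine ⟨M, hM, fun n hn x y hxy => ?_⟩
  have := h n hn x y fun i hi => congrFun hxy ⟨i, hi⟩
  rwa [div_le_iff₀ ((hf n hn).2 y)] at this

/-- Superadditivity, with a multiplicative constant moved to the other side. -/
theorem IsSuperadditive.exists_bound (hsup : IsSuperadditive X f) :
    ∃ D : ℝ, 1 ≤ D ∧ ∀ m n, 1 ≤ m → 1 ≤ n → ∀ x : Pt X,
      f m x * f n ((shiftMap X)^[m] x) ≤ D * f (m + n) x := by
  obtain ⟨C, hC, h⟩ := hsup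
  refine ⟨Real.exp C, Real.one_le_exp hC, fun m n hm hn x => ?_⟩
  have := mul_le_mul_of_nonneg_left (h m n hm hn x) (Real.exp_pos C).le
  rwa [← mul_assoc, ← mul_assoc, ← Real.exp_add, add_neg_cancel, Real.exp_zero, one_mul] at this

/-- A point of the cylinder `[u]`, for an allowable word `u`. -/
def representative (X : OneSidedSubshift d) [Nonempty (Pt X)] {n : ℕ} (u : Fin n → Fin d) :
    Pt X :=
  Classical.epsilon fun x => x ∈ cyl X u

variable [Nonempty (Pt X)]

theorem representative_mem {n : ℕ} {u : Fin n → Fin d} (hu : u ∈ words X n) :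
    representative X u ∈ cyl X u :=
  Classical.epsilon_spec ((mem_words_iff.1 hu).imp fun _ hx => mem_cyl_iff.2 hx)

theorem prefixWord_representative {n : ℕ} {u : Fin n → Fin d} (hu : u ∈ words X n) :
    prefixWord n (representative X u) = u :=
  mem_cyl_iff.1 (representative_mem hu)

/-- The weight of a word `u` of length `n`: the value of `f_n` at a chosen point of `[u]`. -/
def weight (f : ℕ → Pt X → ℝ) {n : ℕ} (u : Fin n → Fin d) : ℝ := f n (representative X u)

/-- The total weight of the allowable words of length `n`. -/
def weightSum (f : ℕ → Pt X → ℝ) (n : ℕ) : ℝ := ∑ u ∈ words X n, weight f u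

/-- The total weight of the words `uv` with `v ∈ F_n(u)`. -/
def rightSum (f : ℕ → Pt X → ℝ) ⦃m : ℕ⦄ (u : Fin m → Fin d) (n : ℕ) : ℝ :=
  ∑ v ∈ followers X u n, weight f (Fin.append u v)

/-- The total weight of the words `vu` with `v ∈ P_n(u)`. -/
def leftSum (f : ℕ → Pt X → ℝ) ⦃m : ℕ⦄ (u : Fin m → Fin d) (n : ℕ) : ℝ :=
  ∑ v ∈ predecessors X u n, weight f (Fin.append v u)

theorem IsContinuousSequence.weight_pos (hf : IsContinuousSequence X f) {n : ℕ} (hn : 1 ≤ n)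
    (u : Fin n → Fin d) : 0 < weight f u :=
  (hf n hn).2 _

theorem words_nonempty (n : ℕ) : (words X n).Nonempty :=
  ⟨_, prefixWord_mem_words n (Classical.arbitrary (Pt X))⟩

theorem IsContinuousSequence.weightSum_pos (hf : IsContinuousSequence X f) {n : ℕ} (hn : 1 ≤ n) :
    0 < weightSum f n :=
  Finset.sum_pos (fun u _ => hf.weight_pos hn u) (words_nonempty n)

theorem sum_rightSum (m n : ℕ) :
    ∑ u ∈ words X m, rightSum f u n = weightSum f (m + n) :=
  sum_followers m n (weight f)

theorem sum_leftSum (m n : ℕ) :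
    ∑ u ∈ words X m, leftSum f u n = weightSum f (m + n) := by
  rw [Nat.add_comm m n]
  exact sum_predecessors m n (weight f)

theorem IsContinuousSequence.exists_lower_bound (hf : IsContinuousSequence X f) {n : ℕ}
    (hn : 1 ≤ n) : ∃ a : ℝ, 0 < a ∧ ∀ x, a ≤ f n x := by
  obtain ⟨x, -, hx⟩ := isCompact_univ.exists_isMinOn Set.univ_nonempty (hf n hn).1.continuousOn
  exact ⟨f n x, (hf n hn).2 x, fun y => hx (Set.mem_univ y)⟩

/-- Under bounded variation, `f_n` on a cylinder is comparable with the weight of its word. -/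
theorem HasBoundedVariation.exists_weight_bound (hf : IsContinuousSequence X f)
    (hbv : HasBoundedVariation X f) :
    ∃ M : ℝ, 1 ≤ M ∧ ∀ n, 1 ≤ n → ∀ x : Pt X,
      f n x ≤ M * weight f (prefixWord n x) ∧ weight f (prefixWord n x) ≤ M * f n x := by
  obtain ⟨M, hM, h⟩ := hbv.exists_bound hf
  refine ⟨M, hM, fun n hn x => ?_⟩
  have h1 := prefixWord_representative (prefixWord_mem_words n x)
  exact ⟨h n hn _ _ h1.symm, h n hn _ _ h1⟩

/-- Appending `j` letters on the right decreases `f` by at most a factor depending on `j`. -/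
theorem exists_extend_right (hf : IsContinuousSequence X f) (hsup : IsSuperadditive X f) {j : ℕ}
    (hj : 1 ≤ j) : ∃ D : ℝ, 0 < D ∧ ∀ n, 1 ≤ n → ∀ x : Pt X, f n x ≤ D * f (n + j) x := by
  obtain ⟨D, hD, h⟩ := hsup.exists_bound
  obtain ⟨a, ha, hax⟩ := hf.exists_lower_bound hj
  refine ⟨D / a, by positivity, fun n hn x => ?_⟩
  rw [div_mul_eq_mul_div, le_div_iff₀ ha]
  exact (mul_le_mul_of_nonneg_left (hax _) ((hf n hn).2 x).le).trans (h n j hn hj x)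

/-- Prepending `j` letters on the left decreases `f` by at most a factor depending on `j`. -/
theorem exists_extend_left (hf : IsContinuousSequence X f) (hsup : IsSuperadditive X f) {j : ℕ}
    (hj : 1 ≤ j) : ∃ D : ℝ, 0 < D ∧ ∀ n, 1 ≤ n → ∀ x : Pt X,
      f n ((shiftMap X)^[j] x) ≤ D * f (j + n) x := by
  obtain ⟨D, hD, h⟩ := hsup.exists_bound
  obtain ⟨a, ha, hax⟩ := hf.exists_lower_bound hj
  refine ⟨D / a, by positivity, fun n hn x => ?_⟩
  rw [div_mul_eq_mul_div, le_div_iff₀ ha, mul_comm]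
  exact (mul_le_mul_of_nonneg_right (hax _) ((hf n hn).2 _).le).trans (h j n hj hn x)

end

section

variable {d : ℕ} {X : OneSidedSubshift d} [Nonempty (Pt X)] {f : ℕ → Pt X → ℝ} {k : ℕ}

/-! ### Extension sums: balance against the upper inequality -/

/-- The properties of the sums `S u n` of the weights of the extensions of `u` by `n` letters that
do not depend on the side on which the letters are added. -/
structure ExtensionSum (f : ℕ → Pt X → ℝ) (k : ℕ)
    (S : ∀ ⦃m : ℕ⦄, (Fin m → Fin d) → ℕ → ℝ) : Prop where
  /-- The words `u` of a fixed length account for all longer words. -/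
  sum_eq : ∀ m n, ∑ u ∈ words X m, S u n = weightSum f (m + n)
  /-- A longer extension decreases the sum at most by a factor depending on the added length. -/
  le_add : ∀ j, 1 ≤ j → ∃ D : ℝ, 0 < D ∧ ∀ m n, 1 ≤ m → 1 ≤ n → ∀ u ∈ words X m,
    S u n ≤ D * S u (n + j)
  /-- Each word of length `n` can be attached to `u` by a connecting word of length `k`. -/
  spec : ∃ D : ℝ, 0 < D ∧ ∀ m n, 1 ≤ m → 1 ≤ n → ∀ u ∈ words X m,
    weight f u * weightSum f n ≤ D * S u (n + k)
  /-- Some extension of `u` by `j` letters has a weight comparable with that of `u`. -/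
  weight_le : ∀ j, 1 ≤ j → ∃ D : ℝ, 0 < D ∧ ∀ m, 1 ≤ m → ∀ u ∈ words X m,
    weight f u ≤ D * S u j

/-- The balance condition for the sums `S`, for extensions by at least `K` letters. -/
def SumBalanced (f : ℕ → Pt X → ℝ) (S : ∀ ⦃m : ℕ⦄, (Fin m → Fin d) → ℕ → ℝ) (K : ℕ) : Prop :=
  ∃ C : ℝ, 1 ≤ C ∧ ∀ m n, 1 ≤ m → K ≤ n → ∀ u ∈ words X m,
    S u n ≤ C * (weight f u * weightSum f n) ∧ weight f u * weightSum f n ≤ C * S u n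

/-- The upper inequality for the sums `S`. -/
def SumUpper (f : ℕ → Pt X → ℝ) (k : ℕ) (S : ∀ ⦃m : ℕ⦄, (Fin m → Fin d) → ℕ → ℝ) : Prop :=
  ∃ C : ℝ, 1 ≤ C ∧ ∀ m n, 1 ≤ m → 1 ≤ n → ∀ u ∈ words X m,
    S u (n + k) ≤ C * (weight f u * weightSum f n)

theorem ExtensionSum.right (hf : IsContinuousSequence X f) (hsup : IsSuperadditive X f)
    (hbv : HasBoundedVariation X f) (hk : HasStrongSpecification X k) :
    ExtensionSum f k (rightSum f) where
  sum_eq := sum_rightSum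
  le_add j hj := by
    obtain ⟨M, hM, hMx⟩ := hbv.exists_weight_bound hf
    obtain ⟨D, hD, h⟩ := exists_extend_right hf hsup hj
    refine ⟨D * M, by positivity, fun m n hm hn u hu => ?_⟩
    refine sum_le_mul_sum_of_injOn
      (fun v => prefixWord (n + j) ((shiftMap X)^[m] (representative X (Fin.append u v))))
      (fun v hv => ?_) (fun v hv v' hv' hvv => ?_) (fun v hv => (hf.weight_pos (by omega) _).le)
      (by positivity) (fun v hv => ?_)
    · have h1 := prefixWord_representative (mem_followers_iff.1 hv)
      rw [prefixWord_add_eq_append_iff] at h1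
      rw [mem_followers_iff]
      nth_rw 1 [← h1.1]
      rw [append_prefixWord]
      exact prefixWord_mem_words _ _
    · have h1 := prefixWord_representative (mem_followers_iff.1 hv)
      have h2 := prefixWord_representative (mem_followers_iff.1 hv')
      rw [prefixWord_add_eq_append_iff] at h1 h2
      rw [← h1.2, ← h2.2]
      exact prefixWord_eq_of_le (Nat.le_add_right n j) hvv
    · have h1 := prefixWord_representative (mem_followers_iff.1 hv)
      rw [prefixWord_add_eq_append_iff] at h1
      set x := representative X (Fin.append u v) with hx
      have h2 : Fin.append u (prefixWord (n + j) ((shiftMap X)^[m] x)) =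
          prefixWord (m + (n + j)) x := by
        nth_rw 1 [← h1.1]
        rw [append_prefixWord]
      rw [h2, mul_assoc]
      refine (h (m + n) (by omega) x).trans (mul_le_mul_of_nonneg_left ?_ hD.le)
      rw [Nat.add_assoc]
      exact (hMx _ (by omega) x).1
  spec := by
    obtain ⟨M, hM, hMx⟩ := hbv.exists_weight_bound hf
    obtain ⟨D, hD, h⟩ := exists_extend_left hf hsup hk.1
    obtain ⟨E, hE, h'⟩ := hsup.exists_bound
    refine ⟨M * M * D * E * M, by positivity, fun m n hm hn u hu => ?_⟩
    rw [weightSum, Finset.mul_sum, Nat.add_comm n k]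
    have hpt : ∀ v : Fin n → Fin d, ∃ x : Pt X, v ∈ words X n → prefixWord m x = u ∧
        prefixWord n ((shiftMap X)^[m + k] x) = v := fun v => by
      by_cases hv : v ∈ words X n
      · obtain ⟨x, hx⟩ := hk.exists_point hu hv
        exact ⟨x, fun _ => hx⟩
      · exact ⟨Classical.arbitrary _, fun h => absurd h hv⟩
    choose x hx using hpt
    have happ : ∀ v ∈ words X n, Fin.append u (prefixWord (k + n) ((shiftMap X)^[m] (x v))) =
          prefixWord (m + (k + n)) (x v) := fun v hv => by
      nth_rw 1 [← (hx v hv).1]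
      rw [append_prefixWord]
    refine sum_le_mul_sum_of_injOn
      (fun v => prefixWord (k + n) ((shiftMap X)^[m] (x v)))
      (fun v hv => ?_) (fun v hv v' hv' hvv => ?_) (fun v hv => (hf.weight_pos (by omega) _).le)
      (by positivity) (fun v hv => ?_)
    · rw [mem_followers_iff, happ v hv]
      exact prefixWord_mem_words _ _
    · simp only [← append_prefixWord k n, append_eq_iff, ← Function.iterate_add_apply] at hvv
      rw [Nat.add_comm k m] at hvv
      rw [← (hx v hv).2, ← (hx v' hv').2, hvv.2]
    · rw [happ v hv]
      have h1 : weight f u ≤ M * f m (x v) := by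
        have := (hMx m hm (x v)).2
        rwa [(hx v hv).1] at this
      have h2 : weight f v ≤ M * (D * f (k + n) ((shiftMap X)^[m] (x v))) := by
        have := (hMx n hn ((shiftMap X)^[m + k] (x v))).2
        rw [(hx v hv).2, Nat.add_comm m k, Function.iterate_add_apply] at this
        exact this.trans (mul_le_mul_of_nonneg_left (h n hn _) (by positivity))
      have h3 := h' m (k + n) hm (by omega) (x v)
      have h4 := (hMx (m + (k + n)) (by omega) (x v)).1
      calc weight f u * weight f v
          ≤ (M * f m (x v)) * (M * (D * f (k + n) ((shiftMap X)^[m] (x v)))) :=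
            mul_le_mul h1 h2 (hf.weight_pos hn _).le
              (mul_nonneg (by positivity) ((hf m hm).2 _).le)
        _ = M * M * D * (f m (x v) * f (k + n) ((shiftMap X)^[m] (x v))) := by ring
        _ ≤ M * M * D * (E * (M * weight f (prefixWord (m + (k + n)) (x v))))  :=
          mul_le_mul_of_nonneg_left (h3.trans (by gcongr)) (by positivity)
        _ = _ := by ring
  weight_le j hj := by
    obtain ⟨M, hM, hMx⟩ := hbv.exists_weight_bound hf
    obtain ⟨D, hD, h⟩ := exists_extend_right hf hsup hj
    refine ⟨D * M, by positivity, fun m hm u hu => ?_⟩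
    set x := representative X u with hx
    have h1 : prefixWord m x = u := prefixWord_representative hu
    have h2 : Fin.append u (prefixWord j ((shiftMap X)^[m] x)) = prefixWord (m + j) x := by
      rw [← append_prefixWord, h1]
    have h3 : prefixWord j ((shiftMap X)^[m] x) ∈ followers X u j := by
      rw [mem_followers_iff, h2]
      exact prefixWord_mem_words _ _
    calc weight f u ≤ D * f (m + j) x := h m hm x
      _ ≤ D * (M * weight f (prefixWord (m + j) x)) := by gcongr; exact (hMx _ (by omega) x).1
      _ = D * M * weight f (Fin.append u (prefixWord j ((shiftMap X)^[m] x))) := by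
        rw [h2, mul_assoc]
      _ ≤ D * M * rightSum f u j := by
        gcongr
        exact Finset.single_le_sum (f := fun v => weight f (Fin.append u v))
          (fun v _ => (hf.weight_pos (by omega) _).le) h3

theorem ExtensionSum.left (hf : IsContinuousSequence X f) (hsup : IsSuperadditive X f)
    (hbv : HasBoundedVariation X f) (hk : HasStrongSpecification X k) :
    ExtensionSum f k (leftSum f) where
  sum_eq := sum_leftSum
  le_add j hj := by
    obtain ⟨M, hM, hMx⟩ := hbv.exists_weight_bound hf
    obtain ⟨D, hD, h⟩ := exists_extend_left hf hsup hj
    refine ⟨M * D * M, by positivity, fun m n hm hn u hu => ?_⟩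
    rw [Nat.add_comm n j]
    have hpt : ∀ v : Fin n → Fin d, ∃ x : Pt X, v ∈ predecessors X u n →
        prefixWord (n + m) ((shiftMap X)^[j] x) = Fin.append v u := fun v => by
      by_cases hv : v ∈ predecessors X u n
      · obtain ⟨x, hx⟩ := hk.exists_preimage (mem_predecessors_iff.1 hv) j
        exact ⟨x, fun _ => hx⟩
      · exact ⟨Classical.arbitrary _, fun h => absurd h hv⟩
    choose x hx using hpt
    have happ : ∀ v ∈ predecessors X u n, Fin.append (prefixWord (j + n) (x v)) u =
          prefixWord (j + n + m) (x v) := fun v hv => by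
      have h1 := hx v hv
      rw [prefixWord_add_eq_append_iff, ← Function.iterate_add_apply, Nat.add_comm n j] at h1
      rw [← append_prefixWord (j + n) m, h1.2]
    refine sum_le_mul_sum_of_injOn (fun v => prefixWord (j + n) (x v))
      (fun v hv => ?_) (fun v hv v' hv' hvv => ?_) (fun v hv => (hf.weight_pos (by omega) _).le)
      (by positivity) (fun v hv => ?_)
    · rw [mem_predecessors_iff, happ v hv]
      exact prefixWord_mem_words _ _
    · have h1 := hx v hv
      have h2 := hx v' hv'
      rw [prefixWord_add_eq_append_iff] at h1 h2
      simp only [← append_prefixWord j n, append_eq_iff] at hvv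
      rw [← h1.1, ← h2.1, hvv.2]
    · rw [happ v hv]
      have h1 := (hMx (n + m) (by omega) ((shiftMap X)^[j] (x v))).2
      rw [hx v hv] at h1
      have h2 := h (n + m) (by omega) (x v)
      rw [← Nat.add_assoc] at h2
      have h3 := (hMx (j + n + m) (by omega) (x v)).1
      calc weight f (Fin.append v u) ≤ M * (D * (M * weight f (prefixWord (j + n + m) (x v)))) :=
            h1.trans (by gcongr; exact h2.trans (by gcongr))
        _ = _ := by ring
  spec := by
    obtain ⟨M, hM, hMx⟩ := hbv.exists_weight_bound hf
    obtain ⟨D, hD, h⟩ := exists_extend_right hf hsup hk.1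
    obtain ⟨E, hE, h'⟩ := hsup.exists_bound
    refine ⟨M * M * D * E * M, by positivity, fun m n hm hn u hu => ?_⟩
    rw [weightSum, Finset.mul_sum]
    have hpt : ∀ v : Fin n → Fin d, ∃ x : Pt X, v ∈ words X n → prefixWord n x = v ∧
        prefixWord m ((shiftMap X)^[n + k] x) = u := fun v => by
      by_cases hv : v ∈ words X n
      · obtain ⟨x, hx⟩ := hk.exists_point hv hu
        exact ⟨x, fun _ => hx⟩
      · exact ⟨Classical.arbitrary _, fun h => absurd h hv⟩
    choose x hx using hpt
    have happ : ∀ v ∈ words X n, Fin.append (prefixWord (n + k) (x v)) u =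
          prefixWord (n + k + m) (x v) := fun v hv => by
      rw [← append_prefixWord (n + k) m, (hx v hv).2]
    refine sum_le_mul_sum_of_injOn (fun v => prefixWord (n + k) (x v))
      (fun v hv => ?_) (fun v hv v' hv' hvv => ?_) (fun v hv => (hf.weight_pos (by omega) _).le)
      (by positivity) (fun v hv => ?_)
    · rw [mem_predecessors_iff, happ v hv]
      exact prefixWord_mem_words _ _
    · rw [← (hx v hv).1, ← (hx v' hv').1]
      exact prefixWord_eq_of_le (Nat.le_add_right n k) hvv
    · rw [happ v hv]
      have h1 : weight f u ≤ M * f m ((shiftMap X)^[n + k] (x v)) := by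
        have := (hMx m hm ((shiftMap X)^[n + k] (x v))).2
        rwa [(hx v hv).2] at this
      have h2 : weight f v ≤ M * (D * f (n + k) (x v)) := by
        have := (hMx n hn (x v)).2
        rw [(hx v hv).1] at this
        exact this.trans (mul_le_mul_of_nonneg_left (h n hn _) (by positivity))
      have h3 := h' (n + k) m (by omega) hm (x v)
      have h4 := (hMx (n + k + m) (by omega) (x v)).1
      calc weight f u * weight f v
          ≤ (M * f m ((shiftMap X)^[n + k] (x v))) * (M * (D * f (n + k) (x v))) :=
            mul_le_mul h1 h2 (hf.weight_pos hn _).le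
              (mul_nonneg (by positivity) ((hf m hm).2 _).le)
        _ = M * M * D * (f (n + k) (x v) * f m ((shiftMap X)^[n + k] (x v))) := by ring
        _ ≤ M * M * D * (E * (M * weight f (prefixWord (n + k + m) (x v)))) :=
          mul_le_mul_of_nonneg_left (h3.trans (by gcongr)) (by positivity)
        _ = _ := by ring
  weight_le j hj := by
    obtain ⟨M, hM, hMx⟩ := hbv.exists_weight_bound hf
    obtain ⟨D, hD, h⟩ := exists_extend_left hf hsup hj
    refine ⟨M * D * M, by positivity, fun m hm u hu => ?_⟩
    obtain ⟨x, hx⟩ := hk.exists_preimage hu j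
    have h2 : Fin.append (prefixWord j x) u = prefixWord (j + m) x := by
      rw [← append_prefixWord, hx]
    have h3 : prefixWord j x ∈ predecessors X u j := by
      rw [mem_predecessors_iff, h2]
      exact prefixWord_mem_words _ _
    have h1 := (hMx m hm ((shiftMap X)^[j] x)).2
    rw [hx] at h1
    calc weight f u ≤ M * (D * (M * weight f (prefixWord (j + m) x))) :=
          h1.trans (by gcongr; exact (h m hm x).trans (by gcongr; exact (hMx _ (by omega) x).1))
      _ = M * D * M * weight f (Fin.append (prefixWord j x) u) := by rw [h2]; ring
      _ ≤ M * D * M * leftSum f u j := by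
        gcongr
        exact Finset.single_le_sum (f := fun v => weight f (Fin.append v u))
          (fun v _ => (hf.weight_pos (by omega) _).le) h3

section Abstract

variable {S : ∀ ⦃m : ℕ⦄, (Fin m → Fin d) → ℕ → ℝ}

theorem ExtensionSum.weightSum_le_add (hS : ExtensionSum f k S) {j : ℕ} (hj : 1 ≤ j) :
    ∃ D : ℝ, 0 < D ∧ ∀ n, 1 ≤ n → weightSum f n ≤ D * weightSum f (n + j) := by
  obtain ⟨D, hD, h⟩ := hS.weight_le j hj
  refine ⟨D, hD, fun n hn => ?_⟩
  rw [← hS.sum_eq, Finset.mul_sum]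
  exact Finset.sum_le_sum fun u hu => h n hn u hu

theorem ExtensionSum.weightSum_add_le (hS : ExtensionSum f k S) {m n : ℕ} {B : ℝ}
    (h : ∀ u ∈ words X m, S u n ≤ B * weight f u) :
    weightSum f (m + n) ≤ B * weightSum f m := by
  rw [← hS.sum_eq, weightSum, Finset.mul_sum]
  exact Finset.sum_le_sum h

/-- Balance for long extensions is balance for all extensions: from above by lengthening a short
extension, from below because only finitely many lengths have to be added. -/
theorem ExtensionSum.balanced_one (hf : IsContinuousSequence X f) (hS : ExtensionSum f k S)
    {K : ℕ} (hK : 1 ≤ K) (h : SumBalanced f S K) : SumBalanced f S 1 := by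
  obtain ⟨C, hC, hb⟩ := h
  obtain ⟨D, hD, hadd⟩ := hS.le_add K hK
  -- For each length `n` a constant for the lower bound, from the weight of a single extension.
  have hlow : ∀ n, 1 ≤ n → ∃ E : ℝ, 0 < E ∧ ∀ m, 1 ≤ m → ∀ u ∈ words X m,
      weight f u * weightSum f n ≤ E * S u n := by
    intro n hn
    obtain ⟨E, hE, h⟩ := hS.weight_le n hn
    have hZ := hf.weightSum_pos (X := X) hn
    refine ⟨E * weightSum f n, by positivity, fun m hm u hu => ?_⟩
    calc weight f u * weightSum f n ≤ E * S u n * weightSum f n := by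
          gcongr; exact h m hm u hu
      _ = _ := by ring
  choose! E hE hEl using hlow
  have hZK := hf.weightSum_pos (X := X) hK
  set A := D * (C * (C * weightSum f K)) with hA
  set B := ∑ n ∈ Finset.range K, |E n| with hB
  have hB0 : 0 ≤ B := Finset.sum_nonneg fun _ _ => abs_nonneg _
  have hA0 : 0 ≤ A := by positivity
  refine ⟨A + B + C, by linarith, fun m n hm hn u hu => ?_⟩
  have hw := hf.weight_pos hm u
  have hZ := hf.weightSum_pos (X := X) hn
  have hS0 : 0 < S u n :=
    pos_of_mul_pos_right ((mul_pos hw hZ).trans_le (hEl n hn m hm u hu)) (hE n hn).le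
  constructor
  · have h1 : weightSum f (n + K) ≤ C * weightSum f K * weightSum f n :=
      hS.weightSum_add_le fun u hu => by
        have := (hb n K hn le_rfl u hu).1
        linarith
    calc S u n ≤ D * S u (n + K) := hadd m n hm hn u hu
      _ ≤ D * (C * (weight f u * weightSum f (n + K))) := by
        gcongr; exact (hb m (n + K) hm (by omega) u hu).1
      _ ≤ D * (C * (weight f u * (C * weightSum f K * weightSum f n))) := by gcongr
      _ = A * (weight f u * weightSum f n) := by rw [hA]; ring
      _ ≤ _ := by gcongr; linarith
  · rcases lt_or_ge n K with hlt | hge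
    · calc weight f u * weightSum f n ≤ E n * S u n := hEl n hn m hm u hu
        _ ≤ _ := by
          gcongr
          have : |E n| ≤ B := Finset.single_le_sum (f := fun n => |E n|)
            (fun _ _ => abs_nonneg _) (Finset.mem_range.2 hlt)
          linarith [le_abs_self (E n)]
    · calc weight f u * weightSum f n ≤ C * S u n := (hb m n hm hge u hu).2
        _ ≤ _ := by gcongr; linarith

theorem ExtensionSum.upper_of_balanced (hf : IsContinuousSequence X f) (hS : ExtensionSum f k S)
    (hk : 1 ≤ k) (h : SumBalanced f S 1) : SumUpper f k S := by
  obtain ⟨C, hC, hb⟩ := h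
  have hZk := hf.weightSum_pos (X := X) hk
  refine ⟨C * (C * weightSum f k) + 1, by linarith [show 0 < C * (C * weightSum f k) by positivity],
    fun m n hm hn u hu => ?_⟩
  have h1 : weightSum f (n + k) ≤ C * weightSum f k * weightSum f n :=
    hS.weightSum_add_le fun u hu => by
      have := (hb n k hn hk u hu).1
      linarith
  have hw := hf.weight_pos hm u
  have hZ := hf.weightSum_pos (X := X) hn
  calc S u (n + k) ≤ C * (weight f u * weightSum f (n + k)) := (hb m (n + k) hm (by omega) u hu).1
    _ ≤ C * (weight f u * (C * weightSum f k * weightSum f n)) := by gcongr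
    _ = C * (C * weightSum f k) * (weight f u * weightSum f n) := by ring
    _ ≤ _ := by gcongr; linarith

theorem ExtensionSum.balanced_of_upper (hf : IsContinuousSequence X f) (hS : ExtensionSum f k S)
    (hk : 1 ≤ k) (h : SumUpper f k S) : SumBalanced f S (k + 2) := by
  obtain ⟨C, hC, hu⟩ := h
  obtain ⟨D, hD, hD'⟩ := hS.weightSum_le_add hk
  obtain ⟨E, hE, hE'⟩ := hS.spec
  obtain ⟨F, hF, hF'⟩ := hS.weightSum_le_add le_rfl
  have hZ1 := hf.weightSum_pos (X := X) le_rfl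
  refine ⟨C * D + C * weightSum f 1 * F * E + 1, by
    linarith [show 0 < C * D by positivity, show 0 < C * weightSum f 1 * F * E by positivity],
    fun m n hm hn u hu' => ?_⟩
  -- Removing the `k` letters of the connecting word leaves `l + 1` letters, with `l ≥ 1`.
  obtain ⟨l, hl, rfl⟩ : ∃ l, 1 ≤ l ∧ n = l + 1 + k := ⟨n - (k + 1), by omega, by omega⟩
  have hw := hf.weight_pos hm u
  have hZ := hf.weightSum_pos (X := X) (n := l + 1 + k) (by omega)
  have hZl := hf.weightSum_pos (X := X) (n := l) (by omega)
  constructor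
  · calc S u (l + 1 + k) ≤ C * (weight f u * weightSum f (l + 1)) :=
          hu m (l + 1) hm (by omega) u hu'
      _ ≤ C * (weight f u * (D * weightSum f (l + 1 + k))) := by
        gcongr; exact hD' (l + 1) (by omega)
      _ = C * D * (weight f u * weightSum f (l + 1 + k)) := by ring
      _ ≤ _ := by
        gcongr
        linarith [show 0 < C * weightSum f 1 * F * E by positivity]
  · have h1 : weightSum f (1 + (l + k)) ≤ C * weightSum f l * weightSum f 1 :=
      hS.weightSum_add_le fun u hu' => by
        have := hu 1 l le_rfl hl u hu'
        linarith
    rw [show 1 + (l + k) = l + 1 + k by omega] at h1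
    have h2 := hE' m (l + 1) hm (by omega) u hu'
    have hS0 : 0 < S u (l + 1 + k) :=
      pos_of_mul_pos_right ((mul_pos hw (hf.weightSum_pos (by omega))).trans_le h2) hE.le
    calc weight f u * weightSum f (l + 1 + k)
        ≤ weight f u * (C * (F * weightSum f (l + 1)) * weightSum f 1) := by
          gcongr
          exact h1.trans (by gcongr; exact hF' l hl)
      _ = C * weightSum f 1 * F * (weight f u * weightSum f (l + 1)) := by ring
      _ ≤ C * weightSum f 1 * F * (E * S u (l + 1 + k)) := by gcongr
      _ = C * weightSum f 1 * F * E * S u (l + 1 + k) := by ring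
      _ ≤ _ := by gcongr; linarith [show 0 < C * D by positivity]

end Abstract

end

section

variable {d : ℕ} {X : OneSidedSubshift d} {f : ℕ → Pt X → ℝ} {k : ℕ}

/-! ### Arbitrary choices of points in cylinders -/

/-- If all values of `f_m` on a cylinder are comparable with a quantity attached to the cylinder,
then `f` has bounded variation. -/
theorem hasBoundedVariation_of_comparable (hf : IsContinuousSequence X f) {C : ℝ} (hC : 1 ≤ C)
    (h : ∀ m, 1 ≤ m → ∀ u ∈ words X m, ∃ s z : ℝ, 0 < z ∧ ∀ x ∈ cyl X u,
      s ≤ C * (f m x * z) ∧ f m x * z ≤ C * s) : HasBoundedVariation X f := by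
  refine ⟨C * C, by nlinarith, fun n hn x y hxy => ?_⟩
  obtain ⟨s, z, hz, hs⟩ := h n hn _ (prefixWord_mem_words n x)
  have h1 := (hs x (mem_cyl_iff.2 rfl)).2
  have h2 := (hs y (mem_cyl_iff.2 (funext fun i => (hxy i i.2).symm))).1
  rw [div_le_iff₀ ((hf n hn).2 y)]
  refine le_of_mul_le_mul_right ?_ hz
  calc f n x * z ≤ C * s := h1
    _ ≤ C * (C * (f n y * z)) := by gcongr
    _ = C * C * f n y * z := by ring

variable [Nonempty (Pt X)]

theorem one_div_le_div_and_div_le_iff {C a s : ℝ} (hC : 0 < C) (ha : 0 < a) :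
    (1 / C ≤ s / a ∧ s / a ≤ C) ↔ (s ≤ C * a ∧ a ≤ C * s) := by
  rw [div_le_div_iff₀ hC ha, div_le_iff₀ ha, one_mul, mul_comm s C, and_comm]

/-- Under bounded variation, sums of values of `f_n` at arbitrary points of cylinders are
comparable with the sums of the weights. -/
theorem sum_choice_bound {M : ℝ} {n : ℕ}
    (hM : ∀ x : Pt X, f n x ≤ M * weight f (prefixWord n x) ∧
      weight f (prefixWord n x) ≤ M * f n x)
    {ι : Type*} {s : Finset ι} {g : ι → Fin n → Fin d} {y : ι → Pt X}
    (hy : ∀ v ∈ s, y v ∈ cyl X (g v)) :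
    ∑ v ∈ s, f n (y v) ≤ M * ∑ v ∈ s, weight f (g v) ∧
      ∑ v ∈ s, weight f (g v) ≤ M * ∑ v ∈ s, f n (y v) := by
  simp_rw [Finset.mul_sum]
  exact ⟨Finset.sum_le_sum fun v hv => mem_cyl_iff.1 (hy v hv) ▸ (hM (y v)).1,
    Finset.sum_le_sum fun v hv => mem_cyl_iff.1 (hy v hv) ▸ (hM (y v)).2⟩

/-- Transfer of a two-sided bound between sums of weights and sums of values at chosen points. -/
theorem two_sided_bound_transfer {M C w w' s s' z z' : ℝ} (hM : 1 ≤ M) (hC : 1 ≤ C) (hw : 0 ≤ w)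
    (hw' : 0 ≤ w') (hz : 0 ≤ z) (hz' : 0 ≤ z')
    (h1 : s ≤ M * s') (h1' : s' ≤ M * s) (h2 : w ≤ M * w') (h2' : w' ≤ M * w)
    (h3 : z ≤ M * z') (h3' : z' ≤ M * z) (h : s ≤ C * (w * z) ∧ w * z ≤ C * s) :
    s' ≤ M * M * M * C * (w' * z') ∧ w' * z' ≤ M * M * M * C * s' := by
  constructor
  · calc s' ≤ M * s := h1'
      _ ≤ M * (C * ((M * w') * (M * z'))) := by
        gcongr
        exact h.1.trans (by gcongr)
      _ = _ := by ring
  · calc w' * z' ≤ (M * w) * (M * z) := by gcongr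
      _ = M * M * (w * z) := by ring
      _ ≤ M * M * (C * (M * s')) :=
        mul_le_mul_of_nonneg_left (h.2.trans (by gcongr)) (by positivity)
      _ = _ := by ring

theorem rightBalanced_iff (hf : IsContinuousSequence X f) :
    RightBalanced X f ↔ HasBoundedVariation X f ∧ ∃ K, 1 ≤ K ∧ SumBalanced f (rightSum f) K := by
  constructor
  · rintro ⟨C, hC, K, hK, h⟩
    have h' : ∀ m n, 1 ≤ m → K ≤ n → ∀ u ∈ words X m, ∀ x ∈ cyl X u,
        rightSum f u n ≤ C * (f m x * weightSum f n) ∧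
          f m x * weightSum f n ≤ C * rightSum f u n := by
      intro m n hm hn u hu x hx
      have hpos : 0 < f m x * weightSum f n :=
        mul_pos ((hf m hm).2 x) (hf.weightSum_pos (by omega))
      exact (one_div_le_div_and_div_le_iff (by positivity) hpos).1
        (h m n hm hn u hu x hx _ (fun v hv => representative_mem (mem_followers_iff.1 hv)) _
          fun v hv => representative_mem hv)
    refine ⟨hasBoundedVariation_of_comparable hf hC fun m hm u hu =>
      ⟨_, _, hf.weightSum_pos hK, fun x hx => h' m K hm le_rfl u hu x hx⟩, K, hK, C, hC,
      fun m n hm hn u hu => h' m n hm hn u hu _ (representative_mem hu)⟩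
  · rintro ⟨hbv, K, hK, C, hC, h⟩
    obtain ⟨M, hM, hMx⟩ := hbv.exists_weight_bound hf
    refine ⟨M * M * M * C, one_le_mul_of_one_le_of_one_le (one_le_mul_of_one_le_of_one_le
      (one_le_mul_of_one_le_of_one_le hM hM) hM) hC, K, hK, fun m n hm hn u hu x hx y hy z hz => ?_⟩
    have hn1 : 1 ≤ n := by omega
    have hzpos : 0 < ∑ w ∈ words X n, f n (z w) :=
      Finset.sum_pos (fun w _ => (hf n hn1).2 _) (words_nonempty n)
    have hx1 := hMx m hm x
    rw [mem_cyl_iff.1 hx] at hx1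
    have hy1 := sum_choice_bound (hMx (m + n) (by omega)) hy
    have hz1 := sum_choice_bound (g := id) (hMx n hn1) hz
    exact (one_div_le_div_and_div_le_iff (by positivity) (mul_pos ((hf m hm).2 x) hzpos)).2
      (two_sided_bound_transfer hM hC (hf.weight_pos hm u).le ((hf m hm).2 x).le
        (hf.weightSum_pos (X := X) hn1).le hzpos.le hy1.2 hy1.1 hx1.2 hx1.1 hz1.2 hz1.1
        (h m n hm hn u hu))

theorem leftBalanced_iff (hf : IsContinuousSequence X f) :
    LeftBalanced X f ↔ HasBoundedVariation X f ∧ ∃ K, 1 ≤ K ∧ SumBalanced f (leftSum f) K := by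
  constructor
  · rintro ⟨C, hC, K, hK, h⟩
    have h' : ∀ m n, 1 ≤ m → K ≤ n → ∀ u ∈ words X m, ∀ x ∈ cyl X u,
        leftSum f u n ≤ C * (f m x * weightSum f n) ∧
          f m x * weightSum f n ≤ C * leftSum f u n := by
      intro m n hm hn u hu x hx
      have hpos : 0 < f m x * weightSum f n :=
        mul_pos ((hf m hm).2 x) (hf.weightSum_pos (by omega))
      have := (one_div_le_div_and_div_le_iff (by positivity) hpos).1
        (h m n hm hn u hu x hx _ (fun v hv => representative_mem (mem_predecessors_iff.1 hv)) _
          fun v hv => representative_mem hv)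
      rwa [Nat.add_comm m n] at this
    refine ⟨hasBoundedVariation_of_comparable hf hC fun m hm u hu =>
      ⟨_, _, hf.weightSum_pos hK, fun x hx => h' m K hm le_rfl u hu x hx⟩, K, hK, C, hC,
      fun m n hm hn u hu => h' m n hm hn u hu _ (representative_mem hu)⟩
  · rintro ⟨hbv, K, hK, C, hC, h⟩
    obtain ⟨M, hM, hMx⟩ := hbv.exists_weight_bound hf
    refine ⟨M * M * M * C, one_le_mul_of_one_le_of_one_le (one_le_mul_of_one_le_of_one_le
      (one_le_mul_of_one_le_of_one_le hM hM) hM) hC, K, hK, fun m n hm hn u hu x hx y hy z hz => ?_⟩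
    have hn1 : 1 ≤ n := by omega
    have hzpos : 0 < ∑ w ∈ words X n, f n (z w) :=
      Finset.sum_pos (fun w _ => (hf n hn1).2 _) (words_nonempty n)
    have hx1 := hMx m hm x
    rw [mem_cyl_iff.1 hx] at hx1
    have hy1 := sum_choice_bound (hMx (n + m) (by omega)) hy
    have hz1 := sum_choice_bound (g := id) (hMx n hn1) hz
    rw [Nat.add_comm m n]
    exact (one_div_le_div_and_div_le_iff (by positivity) (mul_pos ((hf m hm).2 x) hzpos)).2
      (two_sided_bound_transfer hM hC (hf.weight_pos hm u).le ((hf m hm).2 x).le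
        (hf.weightSum_pos (X := X) hn1).le hzpos.le hy1.2 hy1.1 hx1.2 hx1.1 hz1.2 hz1.1
        (h m n hm hn u hu))

/-- Transfer of an upper bound between sums of weights and sums of values at chosen points. -/
theorem upper_bound_transfer {M C w w' s s' z z' : ℝ} (hM : 1 ≤ M) (hC : 1 ≤ C)
    (hw' : 0 ≤ w') (hz : 0 ≤ z) (h1 : s' ≤ M * s) (h2 : w ≤ M * w')
    (h3 : z ≤ M * z') (h : s ≤ C * (w * z)) :
    s' ≤ M * M * M * C * w' * z' := by
  calc s' ≤ M * s := h1
      _ ≤ M * (C * ((M * w') * (M * z'))) := by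
        gcongr
        exact h.trans (by gcongr)
      _ = _ := by ring

theorem rightUpperInequality_iff (hf : IsContinuousSequence X f) (hbv : HasBoundedVariation X f) :
    RightUpperInequality X f k ↔ SumUpper f k (rightSum f) := by
  constructor
  · rintro ⟨C, hC, h⟩
    refine ⟨C, hC, fun m n hm hn u hu => ?_⟩
    have := h m n hm hn u hu _ (representative_mem hu) _
      (fun v hv => representative_mem (mem_followers_iff.1 hv)) _
      (fun v hv => representative_mem hv)
    rwa [Nat.add_assoc m n k, mul_assoc] at this
  · rintro ⟨C, hC, h⟩
    obtain ⟨M, hM, hMx⟩ := hbv.exists_weight_bound hf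
    refine ⟨M * M * M * C, one_le_mul_of_one_le_of_one_le (one_le_mul_of_one_le_of_one_le
      (one_le_mul_of_one_le_of_one_le hM hM) hM) hC, fun m n hm hn u hu x hx y hy z hz => ?_⟩
    have hx1 := hMx m hm x
    rw [mem_cyl_iff.1 hx] at hx1
    have hy1 := sum_choice_bound (hMx (m + (n + k)) (by omega)) hy
    have hz1 := sum_choice_bound (g := id) (hMx n hn) hz
    rw [Nat.add_assoc m n k]
    exact upper_bound_transfer hM hC ((hf m hm).2 x).le
      (hf.weightSum_pos (X := X) hn).le hy1.1 hx1.2 hz1.2 (h m n hm hn u hu)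

theorem leftUpperInequality_iff (hf : IsContinuousSequence X f) (hbv : HasBoundedVariation X f) :
    LeftUpperInequality X f k ↔ SumUpper f k (leftSum f) := by
  constructor
  · rintro ⟨C, hC, h⟩
    refine ⟨C, hC, fun m n hm hn u hu => ?_⟩
    have := h m n hm hn u hu _ (representative_mem hu) _
      (fun v hv => representative_mem (mem_predecessors_iff.1 hv)) _
      (fun v hv => representative_mem hv)
    rwa [show m + n + k = n + k + m by omega, mul_assoc] at this
  · rintro ⟨C, hC, h⟩
    obtain ⟨M, hM, hMx⟩ := hbv.exists_weight_bound hf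
    refine ⟨M * M * M * C, one_le_mul_of_one_le_of_one_le (one_le_mul_of_one_le_of_one_le
      (one_le_mul_of_one_le_of_one_le hM hM) hM) hC, fun m n hm hn u hu x hx y hy z hz => ?_⟩
    have hx1 := hMx m hm x
    rw [mem_cyl_iff.1 hx] at hx1
    have hy1 := sum_choice_bound (hMx (n + k + m) (by omega)) hy
    have hz1 := sum_choice_bound (g := id) (hMx n hn) hz
    rw [show m + n + k = n + k + m by omega]
    exact upper_bound_transfer hM hC ((hf m hm).2 x).le
      (hf.weightSum_pos (X := X) hn).le hy1.1 hx1.2 hz1.2 (h m n hm hn u hu)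

theorem RightBalanced.sumBalanced (h : RightBalanced X f) (hf : IsContinuousSequence X f)
    (hsup : IsSuperadditive X f) (hk : HasStrongSpecification X k) :
    SumBalanced f (rightSum f) 1 := by
  obtain ⟨hbv, K, hK, hb⟩ := (rightBalanced_iff hf).1 h
  exact (ExtensionSum.right hf hsup hbv hk).balanced_one hf hK hb

theorem LeftBalanced.sumBalanced (h : LeftBalanced X f) (hf : IsContinuousSequence X f)
    (hsup : IsSuperadditive X f) (hk : HasStrongSpecification X k) :
    SumBalanced f (leftSum f) 1 := by
  obtain ⟨hbv, K, hK, hb⟩ := (leftBalanced_iff hf).1 h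
  exact (ExtensionSum.left hf hsup hbv hk).balanced_one hf hK hb

theorem rightBalanced_iff_upper (hf : IsContinuousSequence X f) (hsup : IsSuperadditive X f)
    (hk : HasStrongSpecification X k) :
    RightBalanced X f ↔ HasBoundedVariation X f ∧ RightUpperInequality X f k := by
  constructor
  · intro h
    have hbv := ((rightBalanced_iff hf).1 h).1
    exact ⟨hbv, (rightUpperInequality_iff hf hbv).2
      ((ExtensionSum.right hf hsup hbv hk).upper_of_balanced hf hk.1
        (h.sumBalanced hf hsup hk))⟩
  · rintro ⟨hbv, h⟩
    exact (rightBalanced_iff hf).2 ⟨hbv, k + 2, by omega,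
      (ExtensionSum.right hf hsup hbv hk).balanced_of_upper hf hk.1
        ((rightUpperInequality_iff hf hbv).1 h)⟩

theorem leftBalanced_iff_upper (hf : IsContinuousSequence X f) (hsup : IsSuperadditive X f)
    (hk : HasStrongSpecification X k) :
    LeftBalanced X f ↔ HasBoundedVariation X f ∧ LeftUpperInequality X f k := by
  constructor
  · intro h
    have hbv := ((leftBalanced_iff hf).1 h).1
    exact ⟨hbv, (leftUpperInequality_iff hf hbv).2
      ((ExtensionSum.left hf hsup hbv hk).upper_of_balanced hf hk.1
        (h.sumBalanced hf hsup hk))⟩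
  · rintro ⟨hbv, h⟩
    exact (leftBalanced_iff hf).2 ⟨hbv, k + 2, by omega,
      (ExtensionSum.left hf hsup hbv hk).balanced_of_upper hf hk.1
        ((leftUpperInequality_iff hf hbv).1 h)⟩

/-! ### Exponential growth of almost multiplicative sequences -/

/-- A form of Fekete's lemma: an almost additive sequence stays at bounded distance from a linear
one. -/
theorem exists_abs_sub_mul_le {a : ℕ → ℝ} {B : ℝ}
    (h : ∀ m n, 1 ≤ m → 1 ≤ n → |a (m + n) - a m - a n| ≤ B) :
    ∃ P : ℝ, ∀ n, 1 ≤ n → |a n - n * P| ≤ B := by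
  have hB : 0 ≤ B := (abs_nonneg _).trans (h 1 1 le_rfl le_rfl)
  have hlin : ∀ n, 1 ≤ n → |a n - n * a 1| ≤ n * B := by
    intro n hn
    induction n, hn using Nat.le_induction with
    | base => simpa using hB
    | succ n hn ih =>
      have h1 := h n 1 hn le_rfl
      rw [abs_le] at ih h1 ⊢
      push_cast
      constructor <;> linarith [ih.1, ih.2, h1.1, h1.2]
  -- Both `a + B` and `B - a` are subadditive once their value at `0` is set to `0`.
  set u : ℕ → ℝ := fun n => if n = 0 then 0 else a n + B with hu
  set v : ℕ → ℝ := fun n => if n = 0 then 0 else B - a n with hv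
  have hus : Subadditive u := by
    intro m n
    rcases Nat.eq_zero_or_pos m with rfl | hm
    · simp [hu]
    rcases Nat.eq_zero_or_pos n with rfl | hn
    · simp [hu]
    have := abs_le.1 (h m n hm hn)
    simp only [hu, show m + n ≠ 0 by omega, hm.ne', hn.ne', if_false]
    linarith [this.2]
  have hvs : Subadditive v := by
    intro m n
    rcases Nat.eq_zero_or_pos m with rfl | hm
    · simp [hv]
    rcases Nat.eq_zero_or_pos n with rfl | hn
    · simp [hv]
    have := abs_le.1 (h m n hm hn)
    simp only [hv, show m + n ≠ 0 by omega, hm.ne', hn.ne', if_false]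
    linarith [this.1]
  have hub : BddBelow (Set.range fun n => u n / n) := by
    refine ⟨-(|a 1| + B), ?_⟩
    rintro _ ⟨n, rfl⟩
    rcases Nat.eq_zero_or_pos n with rfl | hn
    · simp only [Nat.cast_zero, div_zero]
      linarith [abs_nonneg (a 1)]
    have hn' : (0 : ℝ) < n := Nat.cast_pos.2 hn
    simp only [hu, hn.ne', if_false]
    rw [le_div_iff₀ hn']
    have := abs_le.1 (hlin n hn)
    nlinarith [neg_abs_le (a 1), this.1]
  have hvb : BddBelow (Set.range fun n => v n / n) := by
    refine ⟨-(|a 1| + B), ?_⟩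
    rintro _ ⟨n, rfl⟩
    rcases Nat.eq_zero_or_pos n with rfl | hn
    · simp only [Nat.cast_zero, div_zero]
      linarith [abs_nonneg (a 1)]
    have hn' : (0 : ℝ) < n := Nat.cast_pos.2 hn
    simp only [hv, hn.ne', if_false]
    rw [le_div_iff₀ hn']
    have := abs_le.1 (hlin n hn)
    nlinarith [le_abs_self (a 1), this.2]
  have hlim : hus.lim + hvs.lim = 0 := by
    refine tendsto_nhds_unique ((hus.tendsto_lim hub).add (hvs.tendsto_lim hvb)) ?_
    refine (tendsto_const_div_atTop_nhds_zero_nat (2 * B)).congr' ?_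
    filter_upwards [eventually_ge_atTop 1] with n hn
    simp only [hu, hv, show n ≠ 0 by omega, if_false]
    ring
  refine ⟨hus.lim, fun n hn => ?_⟩
  have hn' : (0 : ℝ) < n := Nat.cast_pos.2 hn
  have h1 := hus.lim_le_div hub (n := n) (by omega)
  have h2 := hvs.lim_le_div hvb (n := n) (by omega)
  simp only [hu, hv, show n ≠ 0 by omega, if_false] at h1 h2
  rw [le_div_iff₀ hn'] at h1 h2
  rw [abs_le]
  constructor <;> nlinarith

/-- Right balance makes `weightSum` almost multiplicative, so it grows like `e^{nP}`. -/
theorem SumBalanced.exists_exp_bound (hf : IsContinuousSequence X f)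
    (h : SumBalanced f (rightSum f) 1) :
    ∃ P A : ℝ, 1 ≤ A ∧ ∀ n : ℕ, 1 ≤ n →
      weightSum f n ≤ A * Real.exp (n * P) ∧ Real.exp (n * P) ≤ A * weightSum f n := by
  obtain ⟨C, hC, hb⟩ := h
  have hZ : ∀ n, 1 ≤ n → 0 < weightSum f n := fun n hn => hf.weightSum_pos (X := X) hn
  obtain ⟨P, hP⟩ := exists_abs_sub_mul_le (a := fun n => Real.log (weightSum f n))
    (B := Real.log C) fun m n hm hn => by
      have h1 : weightSum f (m + n) ≤ C * (weightSum f m * weightSum f n) := by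
        rw [← sum_rightSum, weightSum, Finset.sum_mul, Finset.mul_sum]
        exact Finset.sum_le_sum fun u hu => (hb m n hm hn u hu).1
      have h2 : weightSum f m * weightSum f n ≤ C * weightSum f (m + n) := by
        rw [← sum_rightSum, weightSum, Finset.sum_mul, Finset.mul_sum]
        exact Finset.sum_le_sum fun u hu => (hb m n hm hn u hu).2
      have hm0 := hZ m hm
      have hn0 := hZ n hn
      have hmn0 := hZ (m + n) (by omega)
      have hC0 : 0 < C := by linarith
      have h1 := Real.log_le_log hmn0 h1
      have h2 := Real.log_le_log (mul_pos hm0 hn0) h2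
      rw [Real.log_mul hC0.ne' (by positivity), Real.log_mul hm0.ne' hn0.ne'] at h1
      rw [Real.log_mul hC0.ne' hmn0.ne', Real.log_mul hm0.ne' hn0.ne'] at h2
      rw [abs_le]
      constructor <;> linarith
  refine ⟨P, C, hC, fun n hn => ?_⟩
  have h1 := abs_le.1 (hP n hn)
  have hC0 : 0 < C := by linarith
  have hn0 := hZ n hn
  constructor
  · rw [← Real.log_le_log_iff hn0 (by positivity), Real.log_mul hC0.ne' (Real.exp_pos _).ne',
      Real.log_exp]
    linarith [h1.2]
  · rw [← Real.log_le_log_iff (Real.exp_pos _) (by positivity), Real.log_mul hC0.ne' hn0.ne',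
      Real.log_exp]
    linarith [h1.1]

end

section

variable {d : ℕ} {X : OneSidedSubshift d}

/-! ### Cylinder sets and measures -/

/-- The finite unions of cylinders: the sets of points determined by finitely many coordinates. -/
def cylinderSets (X : OneSidedSubshift d) : Set (Set (Pt X)) :=
  {A | ∃ (n : ℕ) (S : Set (Fin n → Fin d)), A = prefixWord n ⁻¹' S}

/-- A finite union of cylinders is a union of cylinders of any larger length. -/
theorem preimage_prefixWord_of_le {m n : ℕ} (h : m ≤ n) (S : Set (Fin m → Fin d)) :
    prefixWord (X := X) m ⁻¹' S =
      prefixWord n ⁻¹' {w | (fun i : Fin m => w (Fin.castLE h i)) ∈ S} :=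
  rfl

theorem isSetAlgebra_cylinderSets : IsSetAlgebra (cylinderSets X) where
  empty_mem := ⟨0, ∅, by simp⟩
  compl_mem := by
    rintro _ ⟨n, S, rfl⟩
    exact ⟨n, Sᶜ, rfl⟩
  union_mem := by
    rintro _ _ ⟨m, S, rfl⟩ ⟨n, T, rfl⟩
    rw [preimage_prefixWord_of_le (le_max_left m n) S,
      preimage_prefixWord_of_le (le_max_right m n) T]
    exact ⟨max m n, _, Set.preimage_union.symm⟩

theorem measurableSet_of_mem_cylinderSets {A : Set (Pt X)} (hA : A ∈ cylinderSets X) :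
    MeasurableSet A := by
  obtain ⟨n, S, rfl⟩ := hA
  exact measurable_prefixWord n (Set.toFinite S).measurableSet

theorem isClopen_of_mem_cylinderSets {A : Set (Pt X)} (hA : A ∈ cylinderSets X) : IsClopen A := by
  obtain ⟨n, S, rfl⟩ := hA
  exact (isClopen_discrete S).preimage (continuous_prefixWord n)

theorem cyl_mem_cylinderSets {n : ℕ} (u : Fin n → Fin d) : cyl X u ∈ cylinderSets X :=
  ⟨n, {u}, cyl_eq_preimage u⟩

theorem generateFrom_cylinderSets :
    (inferInstance : MeasurableSpace (Pt X)) = MeasurableSpace.generateFrom (cylinderSets X) := by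
  refine le_antisymm ?_ (MeasurableSpace.generateFrom_le fun A hA =>
    measurableSet_of_mem_cylinderSets hA)
  refine Measurable.comap_le (f := Subtype.val)
    (m₁ := MeasurableSpace.generateFrom (cylinderSets X)) ?_
  refine @measurable_pi_lambda _ _ _ (MeasurableSpace.generateFrom (cylinderSets X)) _ _
    fun i S _ => ?_
  exact MeasurableSpace.measurableSet_generateFrom
    ⟨i + 1, {w | w (Fin.last i) ∈ S}, by ext x; simp [prefixWord]⟩

theorem measureDense_cylinderSets (μ : Measure (Pt X)) [IsFiniteMeasure μ] :
    μ.MeasureDense (cylinderSets X) :=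
  Measure.MeasureDense.of_generateFrom_isSetAlgebra_finite μ isSetAlgebra_cylinderSets
    generateFrom_cylinderSets

/-- Approximation of measurable sets by finite unions of cylinders. -/
theorem exists_cylinderSet_approx (μ : Measure (Pt X)) [IsFiniteMeasure μ] {s : Set (Pt X)}
    (hs : MeasurableSet s) {ε : ℝ} (hε : 0 < ε) :
    ∃ t ∈ cylinderSets X, μ.real (symmDiff s t) < ε := by
  obtain ⟨t, ht, h⟩ := (measureDense_cylinderSets μ).approx s hs (measure_ne_top μ s) ε hε
  exact ⟨t, ht, (ENNReal.ofReal_lt_ofReal_iff hε).1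
    ((ENNReal.ofReal_toReal (measure_ne_top μ _)).symm ▸ h)⟩

theorem ext_of_cylinderSets {μ ν : Measure (Pt X)} [IsFiniteMeasure μ]
    (h : ∀ A ∈ cylinderSets X, μ A = ν A) : μ = ν := by
  refine ext_of_generate_finite (cylinderSets X) generateFrom_cylinderSets ?_ h
    (h _ ⟨0, Set.univ, by simp⟩)
  intro A hA B hB _
  exact isSetAlgebra_cylinderSets.inter_mem hA hB

theorem disjoint_cyl {n : ℕ} {u v : Fin n → Fin d} (h : u ≠ v) : Disjoint (cyl X u) (cyl X v) := by
  rw [Set.disjoint_left]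
  intro x hx hy
  exact h ((mem_cyl_iff.1 hx).symm.trans (mem_cyl_iff.1 hy))

theorem measureReal_preimage_prefixWord (μ : Measure (Pt X)) [IsFiniteMeasure μ] (n : ℕ)
    (S : Set (Fin n → Fin d)) [DecidablePred (· ∈ S)] :
    μ.real (prefixWord n ⁻¹' S) = ∑ w ∈ (words X n).filter (· ∈ S), μ.real (cyl X w) := by
  rw [← measureReal_biUnion_finset (fun u _ v _ h => disjoint_cyl h)
    fun u _ => measurableSet_cyl u]
  congr 1
  ext x
  simp only [Set.mem_preimage, Finset.mem_filter, Set.mem_iUnion, mem_cyl_iff, exists_prop]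
  exact ⟨fun h => ⟨_, ⟨prefixWord_mem_words n x, h⟩, rfl⟩, by rintro ⟨w, ⟨-, h⟩, rfl⟩; exact h⟩

theorem sum_measureReal_cyl (μ : Measure (Pt X)) [IsProbabilityMeasure μ] (n : ℕ) :
    ∑ w ∈ words X n, μ.real (cyl X w) = 1 := by
  classical
  have := measureReal_preimage_prefixWord μ n Set.univ
  simpa using this.symm

theorem cyl_append {m n : ℕ} (u : Fin m → Fin d) (v : Fin n → Fin d) :
    cyl X (Fin.append u v) = cyl X u ∩ (shiftMap X)^[m] ⁻¹' cyl X v := by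
  ext x
  simp only [Set.mem_inter_iff, Set.mem_preimage, mem_cyl_iff, prefixWord_add_eq_append_iff]

theorem measureReal_cyl_eq_sum_followers (μ : Measure (Pt X)) [IsFiniteMeasure μ] {m : ℕ}
    (u : Fin m → Fin d) (n : ℕ) :
    μ.real (cyl X u) = ∑ v ∈ followers X u n, μ.real (cyl X (Fin.append u v)) := by
  rw [← measureReal_biUnion_finset
    (fun v _ v' _ h => disjoint_cyl fun h' => h (append_eq_iff.1 h').2)
    fun v _ => measurableSet_cyl _]
  congr 1
  ext x
  simp only [Set.mem_iUnion, mem_cyl_iff, exists_prop, prefixWord_add_eq_append_iff]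
  refine ⟨fun h => ⟨prefixWord n ((shiftMap X)^[m] x), ?_, h, rfl⟩, fun ⟨_, _, h, _⟩ => h⟩
  rw [mem_followers_iff, ← h, append_prefixWord]
  exact prefixWord_mem_words _ _

theorem measureReal_preimage_cyl_eq_sum_predecessors (μ : Measure (Pt X)) [IsFiniteMeasure μ]
    {m : ℕ} (u : Fin m → Fin d) (n : ℕ) :
    μ.real ((shiftMap X)^[n] ⁻¹' cyl X u) =
      ∑ v ∈ predecessors X u n, μ.real (cyl X (Fin.append v u)) := by
  rw [← measureReal_biUnion_finset
    (fun v _ v' _ h => disjoint_cyl fun h' => h (append_eq_iff.1 h').1)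
    fun v _ => measurableSet_cyl _]
  congr 1
  ext x
  simp only [Set.mem_iUnion, mem_cyl_iff, exists_prop, prefixWord_add_eq_append_iff,
    Set.mem_preimage]
  refine ⟨fun h => ⟨prefixWord n x, ?_, rfl, h⟩, fun ⟨_, _, _, h⟩ => h⟩
  rw [mem_predecessors_iff, ← h, append_prefixWord]
  exact prefixWord_mem_words _ _

theorem measurable_shiftMap : Measurable (shiftMap X) := continuous_shiftMap.measurable

theorem preimage_iterate_mem_cylinderSets {A : Set (Pt X)} (hA : A ∈ cylinderSets X) (n : ℕ) :
    (shiftMap X)^[n] ⁻¹' A ∈ cylinderSets X := by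
  obtain ⟨m, S, rfl⟩ := hA
  refine ⟨n + m, {w | (fun i : Fin m => w (Fin.natAdd n i)) ∈ S}, ?_⟩
  ext x
  simp only [Set.mem_preimage, Set.mem_ofPred_eq]
  have : (prefixWord m ((shiftMap X)^[n] x)) =
      fun i : Fin m => prefixWord (n + m) x (Fin.natAdd n i) := by
    ext i
    simp [prefixWord, shiftMap_iterate_apply]
  rw [this]

theorem exists_prefixWord_of_mem_cylinderSets {A : Set (Pt X)} (hA : A ∈ cylinderSets X) :
    ∃ n, 1 ≤ n ∧ ∃ S : Set (Fin n → Fin d), A = prefixWord n ⁻¹' S := by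
  obtain ⟨n, S, rfl⟩ := hA
  exact ⟨n + 1, by omega, _, preimage_prefixWord_of_le (Nat.le_succ n) S⟩

/-- Domination on cylinders gives absolute continuity. -/
theorem absolutelyContinuous_of_cyl_le {μ ν : Measure (Pt X)} [IsFiniteMeasure μ]
    [IsFiniteMeasure ν] {D : ℝ} (hD : 0 ≤ D)
    (h : ∀ n : ℕ, 1 ≤ n → ∀ u ∈ words X n, μ.real (cyl X u) ≤ D * ν.real (cyl X u)) : μ ≪ ν := by
  classical
  refine Measure.AbsolutelyContinuous.mk fun s hs hνs => ?_
  have hνs' : ν.real s = 0 := by simp [Measure.real, hνs]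
  refine (measureReal_eq_zero_iff).1 (le_antisymm ?_ measureReal_nonneg)
  refine le_of_forall_pos_le_add fun ε hε => ?_
  rw [zero_add]
  obtain ⟨t, ht, hst⟩ := exists_cylinderSet_approx (μ + ν) hs (ε := ε / (1 + D)) (by positivity)
  rw [measureReal_add_apply] at hst
  have h1 : μ.real t ≤ D * ν.real t := by
    obtain ⟨n, hn, S, rfl⟩ := exists_prefixWord_of_mem_cylinderSets ht
    rw [measureReal_preimage_prefixWord μ n S, measureReal_preimage_prefixWord ν n S,
      Finset.mul_sum]
    exact Finset.sum_le_sum fun u hu => h n hn u (Finset.mem_filter.1 hu).1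
  have hsub : ∀ ρ : Measure (Pt X), ∀ [IsFiniteMeasure ρ],
      ρ.real s ≤ ρ.real t + ρ.real (symmDiff s t) ∧
        ρ.real t ≤ ρ.real s + ρ.real (symmDiff s t) := fun ρ _ => by
    have := abs_le.1 (abs_measureReal_sub_le_measureReal_symmDiff (μ := ρ) hs.nullMeasurableSet
      (measurableSet_of_mem_cylinderSets ht).nullMeasurableSet)
    constructor <;> linarith [this.1, this.2]
  have h2 := (hsub μ).1
  have h3 := (hsub ν).2
  have h4 := measureReal_nonneg (μ := μ) (s := symmDiff s t)
  have h5 := measureReal_nonneg (μ := ν) (s := symmDiff s t)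
  rw [lt_div_iff₀ (by positivity)] at hst
  have h6 : D * ν.real t ≤ D * ν.real (symmDiff s t) :=
    mul_le_mul_of_nonneg_left (by linarith) hD
  nlinarith [mul_nonneg hD h4]

/-! ### Gibbs measures -/

variable [Nonempty (Pt X)] {f : ℕ → Pt X → ℝ} {k : ℕ}

/-- The Gibbs inequalities with constants `P` and `C`, stated for the weights of words. -/
def GibbsBound (f : ℕ → Pt X → ℝ) (P C : ℝ) (μ : Measure (Pt X)) : Prop :=
  ∀ n : ℕ, 1 ≤ n → ∀ u ∈ words X n,
    μ.real (cyl X u) ≤ C * (Real.exp (-(n * P)) * weight f u) ∧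
      Real.exp (-(n * P)) * weight f u ≤ C * μ.real (cyl X u)

theorem IsGibbs.exists_gibbsBound (hf : IsContinuousSequence X f) {μ : Measure (Pt X)}
    (h : IsGibbs X f μ) :
    HasBoundedVariation X f ∧ ∃ P C : ℝ, 1 ≤ C ∧ GibbsBound f P C μ := by
  obtain ⟨-, P, C, hC, h⟩ := h
  have h' : ∀ n : ℕ, 1 ≤ n → ∀ u ∈ words X n, ∀ x ∈ cyl X u,
      μ.real (cyl X u) ≤ C * (Real.exp (-(n * P)) * f n x) ∧
      Real.exp (-(n * P)) * f n x ≤ C * μ.real (cyl X u) := fun n hn u hu x hx =>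
    (one_div_le_div_and_div_le_iff hC (mul_pos (Real.exp_pos _) ((hf n hn).2 x))).1
      (h n hn u hu x hx)
  have hC1 : 1 ≤ C := by
    by_contra! hlt
    obtain ⟨u, hu⟩ := words_nonempty (X := X) 1
    have h1 := h' 1 le_rfl u hu _ (representative_mem hu)
    have h0 : 0 < Real.exp (-((1 : ℕ) * P)) * f 1 (representative X u) :=
      mul_pos (Real.exp_pos _) ((hf 1 le_rfl).2 _)
    have h2 : 0 < μ.real (cyl X u) := pos_of_mul_pos_right (h0.trans_le h1.2) hC.le
    nlinarith [h1.1, h1.2]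
  refine ⟨hasBoundedVariation_of_comparable hf hC1 fun m hm u hu =>
    ⟨μ.real (cyl X u), Real.exp (-(m * P)), Real.exp_pos _, fun x hx => ?_⟩, P, C, hC1,
    fun n hn u hu => h' n hn u hu _ (representative_mem hu)⟩
  rw [mul_comm (f m x)]
  exact h' m hm u hu x hx

theorem GibbsBound.isGibbs (hf : IsContinuousSequence X f) (hbv : HasBoundedVariation X f)
    {μ : Measure (Pt X)} [IsProbabilityMeasure μ] {P C : ℝ} (hC : 1 ≤ C)
    (h : GibbsBound f P C μ) : IsGibbs X f μ := by
  obtain ⟨M, hM, hMx⟩ := hbv.exists_weight_bound hf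
  refine ⟨inferInstance, P, C * M, by positivity, fun n hn u hu x hx => ?_⟩
  rw [one_div_le_div_and_div_le_iff (by positivity)
    (mul_pos (Real.exp_pos _) ((hf n hn).2 x))]
  have hx1 := hMx n hn x
  rw [mem_cyl_iff.1 hx] at hx1
  have h1 := h n hn u hu
  constructor
  · calc μ.real (cyl X u) ≤ C * (Real.exp (-(n * P)) * weight f u) := h1.1
      _ ≤ C * (Real.exp (-(n * P)) * (M * f n x)) := by gcongr; exact hx1.2
      _ = _ := by ring
  · calc Real.exp (-(n * P)) * f n x ≤ Real.exp (-(n * P)) * (M * weight f u) := by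
          gcongr; exact hx1.1
      _ = M * (Real.exp (-(n * P)) * weight f u) := by ring
      _ ≤ M * (C * μ.real (cyl X u)) :=
        mul_le_mul_of_nonneg_left h1.2 (by positivity)
      _ = _ := by ring

theorem GibbsBound.weightSum_bound {μ : Measure (Pt X)} [IsProbabilityMeasure μ] {P C : ℝ}
    (h : GibbsBound f P C μ) {n : ℕ} (hn : 1 ≤ n) :
    1 ≤ C * (Real.exp (-(n * P)) * weightSum f n) ∧ Real.exp (-(n * P)) * weightSum f n ≤ C := by
  rw [← sum_measureReal_cyl μ n, weightSum, Finset.mul_sum, Finset.mul_sum]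
  refine ⟨Finset.sum_le_sum fun u hu => (h n hn u hu).1, ?_⟩
  calc ∑ u ∈ words X n, Real.exp (-(n * P)) * weight f u
      ≤ ∑ u ∈ words X n, C * μ.real (cyl X u) :=
        Finset.sum_le_sum fun u hu => (h n hn u hu).2
    _ = C := by rw [← Finset.mul_sum, sum_measureReal_cyl, mul_one]

/-- If sums `S` of weights are, up to constants, the Gibbs weights of sets of `μ`-measure
`μ [u]`, then they are balanced. -/
theorem GibbsBound.sumBalanced (hf : IsContinuousSequence X f) {μ : Measure (Pt X)}
    [IsProbabilityMeasure μ] {P C : ℝ} (hC : 1 ≤ C) (h : GibbsBound f P C μ)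
    {S : ∀ ⦃m : ℕ⦄, (Fin m → Fin d) → ℕ → ℝ}
    (hS : ∀ m n : ℕ, 1 ≤ m → 1 ≤ n → ∀ u ∈ words X m,
      μ.real (cyl X u) ≤ C * (Real.exp (-((m + n : ℕ) * P)) * S u n) ∧
        Real.exp (-((m + n : ℕ) * P)) * S u n ≤ C * μ.real (cyl X u)) :
    SumBalanced f S 1 := by
  refine ⟨C * C * C, one_le_mul_of_one_le_of_one_le (one_le_mul_of_one_le_of_one_le hC hC) hC,
    fun m n hm hn u hu => ?_⟩
  have h1 := hS m n hm hn u hu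
  have h2 := h m hm u hu
  have h3 := h.weightSum_bound hn
  have hw := hf.weight_pos hm u
  have hZ := hf.weightSum_pos (X := X) hn
  have hexp : Real.exp (-((m + n : ℕ) * P)) = Real.exp (-(m * P)) * Real.exp (-(n * P)) := by
    rw [← Real.exp_add]; congr 1; push_cast; ring
  constructor
  · refine le_of_mul_le_mul_left ?_ (Real.exp_pos (-((m + n : ℕ) * P)))
    calc Real.exp (-((m + n : ℕ) * P)) * S u n
        ≤ C * (C * (Real.exp (-(m * P)) * weight f u)) := h1.2.trans (by gcongr; exact h2.1)
      _ ≤ C * (C * (Real.exp (-(m * P)) * weight f u)) *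
          (C * (Real.exp (-(n * P)) * weightSum f n)) := le_mul_of_one_le_right (by positivity) h3.1
      _ = _ := by rw [hexp]; ring
  · refine le_of_mul_le_mul_left ?_ (Real.exp_pos (-((m + n : ℕ) * P)))
    calc Real.exp (-((m + n : ℕ) * P)) * (weight f u * weightSum f n)
        = (Real.exp (-(m * P)) * weight f u) * (Real.exp (-(n * P)) * weightSum f n) := by
          rw [hexp]; ring
      _ ≤ (C * μ.real (cyl X u)) * C :=
          mul_le_mul h2.2 h3.2 (by positivity) (by positivity)
      _ ≤ (C * (C * (Real.exp (-((m + n : ℕ) * P)) * S u n))) * C := by gcongr; exact h1.1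
      _ = _ := by ring

theorem GibbsBound.rightSum_bound {μ : Measure (Pt X)} [IsFiniteMeasure μ] {P C : ℝ}
    (h : GibbsBound f P C μ) {m n : ℕ} (hm : 1 ≤ m) (u : Fin m → Fin d) :
    μ.real (cyl X u) ≤ C * (Real.exp (-((m + n : ℕ) * P)) * rightSum f u n) ∧
      Real.exp (-((m + n : ℕ) * P)) * rightSum f u n ≤ C * μ.real (cyl X u) := by
  rw [measureReal_cyl_eq_sum_followers μ u n, rightSum, Finset.mul_sum, Finset.mul_sum,
    Finset.mul_sum]
  exact ⟨Finset.sum_le_sum fun v hv => (h _ (by omega) _ (mem_followers_iff.1 hv)).1,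
    Finset.sum_le_sum fun v hv => (h _ (by omega) _ (mem_followers_iff.1 hv)).2⟩

theorem GibbsBound.leftSum_bound {μ : Measure (Pt X)} [IsFiniteMeasure μ] {P C : ℝ}
    (h : GibbsBound f P C μ) {m n : ℕ} (hm : 1 ≤ m) (u : Fin m → Fin d) :
    μ.real ((shiftMap X)^[n] ⁻¹' cyl X u) ≤
        C * (Real.exp (-((m + n : ℕ) * P)) * leftSum f u n) ∧
      Real.exp (-((m + n : ℕ) * P)) * leftSum f u n ≤
        C * μ.real ((shiftMap X)^[n] ⁻¹' cyl X u) := by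
  rw [measureReal_preimage_cyl_eq_sum_predecessors μ u n, leftSum, Finset.mul_sum,
    Finset.mul_sum, Finset.mul_sum, Nat.add_comm m n]
  exact ⟨Finset.sum_le_sum fun v hv => (h _ (by omega) _ (mem_predecessors_iff.1 hv)).1,
    Finset.sum_le_sum fun v hv => (h _ (by omega) _ (mem_predecessors_iff.1 hv)).2⟩

/-- An invariant Gibbs measure forces balance: the measure of `[u]` is the sum of the measures of
the cylinders `[uv]`, and, by invariance, of the cylinders `[vu]`. -/
theorem IsErgodicGibbs.balanced (hf : IsContinuousSequence X f) {μ : Measure (Pt X)}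
    (h : IsErgodicGibbs X f μ) : Balanced X f := by
  have := h.1.1
  obtain ⟨hbv, P, C, hC, hb⟩ := h.1.exists_gibbsBound hf
  refine ⟨(rightBalanced_iff hf).2 ⟨hbv, 1, le_rfl, hb.sumBalanced hf hC
    fun m n hm hn u hu => hb.rightSum_bound hm u⟩, (leftBalanced_iff hf).2 ⟨hbv, 1, le_rfl,
    hb.sumBalanced hf hC fun m n hm hn u hu => ?_⟩⟩
  have h1 := hb.leftSum_bound (n := n) hm u
  rwa [(h.2.toMeasurePreserving.iterate n).measureReal_preimage
    (measurableSet_cyl u).nullMeasurableSet] at h1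

end

section

variable {d : ℕ} {X : OneSidedSubshift d} [Nonempty (Pt X)] {f : ℕ → Pt X → ℝ} {k : ℕ}

/-! ### Existence of an invariant Gibbs measure -/

/-- The atomic probability measure that gives the representative of each allowable word of
length `N` a mass proportional to the weight of the word. -/
def wordMeasure (f : ℕ → Pt X → ℝ) (N : ℕ) : Measure (Pt X) :=
  ∑ w ∈ words X N, ENNReal.ofReal (weight f w / weightSum f N) •
    Measure.dirac (representative X w)

theorem isProbabilityMeasure_wordMeasure (hf : IsContinuousSequence X f) {N : ℕ} (hN : 1 ≤ N) :
    IsProbabilityMeasure (wordMeasure f N) := by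
  have hZ := hf.weightSum_pos (X := X) hN
  constructor
  simp only [wordMeasure, Measure.coe_finsetSum, Finset.sum_apply, Measure.smul_apply,
    measure_univ, smul_eq_mul, mul_one]
  rw [← ENNReal.ofReal_sum_of_nonneg fun w _ => div_nonneg (hf.weight_pos hN w).le hZ.le,
    ← Finset.sum_div, ← weightSum, div_self hZ.ne', ENNReal.ofReal_one]

theorem wordMeasure_real_cyl_self (hf : IsContinuousSequence X f) {N : ℕ} (hN : 1 ≤ N)
    {w : Fin N → Fin d} (hw : w ∈ words X N) :
    (wordMeasure f N).real (cyl X w) = weight f w / weightSum f N := by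
  have h : wordMeasure f N (cyl X w) = ENNReal.ofReal (weight f w / weightSum f N) := by
    simp only [wordMeasure, Measure.coe_finsetSum, Finset.sum_apply, Measure.smul_apply,
      Measure.dirac_apply' _ (measurableSet_cyl w), smul_eq_mul]
    rw [Finset.sum_eq_single w]
    · rw [Set.indicator_of_mem (representative_mem hw), Pi.one_apply, mul_one]
    · intro v hv hvw
      rw [Set.indicator_of_notMem, mul_zero]
      intro h
      exact hvw ((prefixWord_representative hv).symm.trans (mem_cyl_iff.1 h))
    · exact fun h => absurd hw h
  rw [Measure.real, h, ENNReal.toReal_ofReal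
    (div_nonneg (hf.weight_pos hN w).le (hf.weightSum_pos (X := X) hN).le)]

theorem wordMeasure_real_cyl (hf : IsContinuousSequence X f) {m n : ℕ} (hm : 1 ≤ m)
    (u : Fin m → Fin d) :
    (wordMeasure f (m + n)).real (cyl X u) = rightSum f u n / weightSum f (m + n) := by
  have := isProbabilityMeasure_wordMeasure (X := X) hf (N := m + n) (by omega)
  rw [measureReal_cyl_eq_sum_followers _ u n, rightSum, Finset.sum_div]
  exact Finset.sum_congr rfl fun v hv =>
    wordMeasure_real_cyl_self hf (by omega) (mem_followers_iff.1 hv)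

/-- The average of the images of `wordMeasure f (2 * N)` under `σ, …, σ^N`. The length `2 * N`
leaves room for a word of length less than `N` after the at most `N` letters removed by the
shift. -/
def averagedMeasure (f : ℕ → Pt X → ℝ) (N : ℕ) : Measure (Pt X) :=
  (N : ENNReal)⁻¹ • ∑ i ∈ Finset.range N, (wordMeasure f (2 * N)).map (shiftMap X)^[i + 1]

theorem averagedMeasure_real (hf : IsContinuousSequence X f) {N : ℕ} (hN : 1 ≤ N)
    {A : Set (Pt X)} (hA : MeasurableSet A) :
    (averagedMeasure f N).real A =
      (∑ i ∈ Finset.range N, (wordMeasure f (2 * N)).real ((shiftMap X)^[i + 1] ⁻¹' A)) / N := by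
  have := isProbabilityMeasure_wordMeasure (X := X) hf (N := 2 * N) (by omega)
  simp only [Measure.real, averagedMeasure, Measure.smul_apply, Measure.coe_finsetSum,
    Finset.sum_apply, smul_eq_mul, ENNReal.toReal_mul, ENNReal.toReal_inv, ENNReal.toReal_natCast]
  rw [ENNReal.toReal_sum fun i _ => by
    rw [Measure.map_apply (measurable_shiftMap.iterate _) hA]; exact measure_ne_top _ _,
    div_eq_inv_mul]
  congr 1
  exact Finset.sum_congr rfl fun i _ => by
    rw [Measure.map_apply (measurable_shiftMap.iterate _) hA]

theorem isProbabilityMeasure_averagedMeasure (hf : IsContinuousSequence X f) {N : ℕ}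
    (hN : 1 ≤ N) : IsProbabilityMeasure (averagedMeasure f N) := by
  have := isProbabilityMeasure_wordMeasure (X := X) hf (N := 2 * N) (by omega)
  constructor
  simp only [averagedMeasure, Measure.smul_apply, Measure.coe_finsetSum,
    Finset.sum_apply, smul_eq_mul, Measure.map_apply (measurable_shiftMap.iterate _)
    MeasurableSet.univ, Set.preimage_univ, measure_univ, Finset.sum_const, Finset.card_range,
    nsmul_eq_mul, mul_one]
  exact ENNReal.inv_mul_cancel (by exact_mod_cast (by omega : N ≠ 0)) (ENNReal.natCast_ne_top N)

/-- The averages are almost invariant. -/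
theorem abs_averagedMeasure_sub_le (hf : IsContinuousSequence X f) {N : ℕ} (hN : 1 ≤ N)
    {A : Set (Pt X)} (hA : MeasurableSet A) :
    |(averagedMeasure f N).real (shiftMap X ⁻¹' A) - (averagedMeasure f N).real A| ≤ 1 / N := by
  have := isProbabilityMeasure_wordMeasure (X := X) hf (N := 2 * N) (by omega)
  have hN0 : (0 : ℝ) < N := by exact_mod_cast hN
  rw [averagedMeasure_real hf hN hA, averagedMeasure_real hf hN (measurable_shiftMap hA),
    ← sub_div, ← Finset.sum_sub_distrib, abs_div, abs_of_pos hN0]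
  gcongr
  have hs : ∀ i, (shiftMap X)^[i + 1] ⁻¹' (shiftMap X ⁻¹' A) = (shiftMap X)^[i + 1 + 1] ⁻¹' A :=
    fun i => by rw [Function.iterate_succ' _ (i + 1), Set.preimage_comp]
  simp_rw [hs]
  rw [Finset.sum_range_sub fun i => (wordMeasure f (2 * N)).real ((shiftMap X)^[i + 1] ⁻¹' A)]
  rw [abs_le]
  constructor <;> linarith [measureReal_nonneg (μ := wordMeasure f (2 * N))
    (s := (shiftMap X)^[N + 1] ⁻¹' A), measureReal_nonneg (μ := wordMeasure f (2 * N))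
    (s := (shiftMap X)^[0 + 1] ⁻¹' A), measureReal_le_one (μ := wordMeasure f (2 * N))
    (s := (shiftMap X)^[N + 1] ⁻¹' A), measureReal_le_one (μ := wordMeasure f (2 * N))
    (s := (shiftMap X)^[0 + 1] ⁻¹' A)]

/-- Right balance gives the Gibbs inequalities for `wordMeasure f N` and words shorter
than `N`. -/
theorem wordMeasure_gibbs (hf : IsContinuousSequence X f) {P A C : ℝ} (hA : 1 ≤ A) (hC : 1 ≤ C)
    (hP : ∀ n : ℕ, 1 ≤ n →
      weightSum f n ≤ A * Real.exp (n * P) ∧ Real.exp (n * P) ≤ A * weightSum f n)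
    (hb : ∀ m n, 1 ≤ m → 1 ≤ n → ∀ u ∈ words X m,
      rightSum f u n ≤ C * (weight f u * weightSum f n) ∧
        weight f u * weightSum f n ≤ C * rightSum f u n)
    {m N : ℕ} (hm : 1 ≤ m) (hmN : m < N) {u : Fin m → Fin d} (hu : u ∈ words X m) :
    (wordMeasure f N).real (cyl X u) ≤ A * A * C * (Real.exp (-(m * P)) * weight f u) ∧
      Real.exp (-(m * P)) * weight f u ≤ A * A * C * (wordMeasure f N).real (cyl X u) := by
  obtain ⟨n, hn, rfl⟩ : ∃ n, 1 ≤ n ∧ N = m + n := ⟨N - m, by omega, by omega⟩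
  have hZ := hf.weightSum_pos (X := X) (n := m + n) (by omega)
  have hw := hf.weight_pos hm u
  have h1 := hb m n hm hn u hu
  have h2 := hP n hn
  have h3 := hP (m + n) (by omega)
  have hexp : Real.exp (n * P) = Real.exp (-(m * P)) * Real.exp ((m + n : ℕ) * P) := by
    rw [← Real.exp_add]; congr 1; push_cast; ring
  rw [wordMeasure_real_cyl hf hm u, div_le_iff₀ hZ, mul_div_assoc', le_div_iff₀ hZ]
  constructor
  · calc rightSum f u n ≤ C * (weight f u * (A * Real.exp (n * P))) :=
          h1.1.trans (by gcongr; exact h2.1)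
      _ ≤ C * (weight f u * (A * (Real.exp (-(m * P)) * (A * weightSum f (m + n))))) := by
        rw [hexp]; gcongr; exact h3.2
      _ = _ := by ring
  · calc Real.exp (-(m * P)) * weight f u * weightSum f (m + n)
        ≤ Real.exp (-(m * P)) * weight f u * (A * Real.exp ((m + n : ℕ) * P)) := by
          gcongr; exact h3.1
      _ = A * (weight f u * Real.exp (n * P)) := by rw [hexp]; ring
      _ ≤ A * (weight f u * (A * weightSum f n)) := by gcongr; exact h2.2
      _ = A * A * (weight f u * weightSum f n) := by ring
      _ ≤ A * A * (C * rightSum f u n) := mul_le_mul_of_nonneg_left h1.2 (by positivity)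
      _ = _ := by ring

/-- Left balance carries the Gibbs inequalities over to the images under iterates of the
shift. -/
theorem wordMeasure_preimage_gibbs (hf : IsContinuousSequence X f) {P A B C : ℝ} (hA : 1 ≤ A)
    (hB : 1 ≤ B) (hC : 1 ≤ C)
    (hP : ∀ n : ℕ, 1 ≤ n →
      weightSum f n ≤ A * Real.exp (n * P) ∧ Real.exp (n * P) ≤ A * weightSum f n)
    (hb : ∀ m n, 1 ≤ m → 1 ≤ n → ∀ u ∈ words X m,
      leftSum f u n ≤ C * (weight f u * weightSum f n) ∧
        weight f u * weightSum f n ≤ C * leftSum f u n)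
    {ν : Measure (Pt X)} [IsFiniteMeasure ν] {m i : ℕ} (hm : 1 ≤ m) (hi : 1 ≤ i)
    (hν : ∀ w ∈ words X (i + m),
      ν.real (cyl X w) ≤ B * (Real.exp (-((i + m : ℕ) * P)) * weight f w) ∧
        Real.exp (-((i + m : ℕ) * P)) * weight f w ≤ B * ν.real (cyl X w))
    {u : Fin m → Fin d} (hu : u ∈ words X m) :
    ν.real ((shiftMap X)^[i] ⁻¹' cyl X u) ≤
        A * B * C * (Real.exp (-(m * P)) * weight f u) ∧
      Real.exp (-(m * P)) * weight f u ≤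
        A * B * C * ν.real ((shiftMap X)^[i] ⁻¹' cyl X u) := by
  have hw := hf.weight_pos hm u
  have h1 := hb m i hm hi u hu
  have h2 := hP i hi
  have hexp : Real.exp (-((i + m : ℕ) * P)) * Real.exp (i * P) = Real.exp (-(m * P)) := by
    rw [← Real.exp_add]; congr 1; push_cast; ring
  have hsum : ν.real ((shiftMap X)^[i] ⁻¹' cyl X u) ≤
        B * (Real.exp (-((i + m : ℕ) * P)) * leftSum f u i) ∧
      Real.exp (-((i + m : ℕ) * P)) * leftSum f u i ≤
        B * ν.real ((shiftMap X)^[i] ⁻¹' cyl X u) := by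
    rw [measureReal_preimage_cyl_eq_sum_predecessors ν u i, leftSum, Finset.mul_sum,
      Finset.mul_sum, Finset.mul_sum]
    exact ⟨Finset.sum_le_sum fun v hv => (hν _ (mem_predecessors_iff.1 hv)).1,
      Finset.sum_le_sum fun v hv => (hν _ (mem_predecessors_iff.1 hv)).2⟩
  constructor
  · calc ν.real ((shiftMap X)^[i] ⁻¹' cyl X u)
        ≤ B * (Real.exp (-((i + m : ℕ) * P)) * (C * (weight f u * (A * Real.exp (i * P))))) :=
          hsum.1.trans (by gcongr; exact h1.1.trans (by gcongr; exact h2.1))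
      _ = A * B * C * (Real.exp (-((i + m : ℕ) * P)) * Real.exp (i * P) * weight f u) := by ring
      _ = _ := by rw [hexp]
  · calc Real.exp (-(m * P)) * weight f u
        = Real.exp (-((i + m : ℕ) * P)) * (weight f u * Real.exp (i * P)) := by
          rw [← hexp]; ring
      _ ≤ Real.exp (-((i + m : ℕ) * P)) * (weight f u * (A * weightSum f i)) := by
        gcongr; exact h2.2
      _ = A * (Real.exp (-((i + m : ℕ) * P)) * (weight f u * weightSum f i)) := by ring
      _ ≤ A * (Real.exp (-((i + m : ℕ) * P)) * (C * leftSum f u i)) :=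
        mul_le_mul_of_nonneg_left (mul_le_mul_of_nonneg_left h1.2 (by positivity)) (by positivity)
      _ = A * C * (Real.exp (-((i + m : ℕ) * P)) * leftSum f u i) := by ring
      _ ≤ A * C * (B * ν.real ((shiftMap X)^[i] ⁻¹' cyl X u)) :=
        mul_le_mul_of_nonneg_left hsum.2 (by positivity)
      _ = _ := by ring

theorem exists_invariant_gibbsBound (hf : IsContinuousSequence X f)
    (hr : SumBalanced f (rightSum f) 1) (hl : SumBalanced f (leftSum f) 1) :
    ∃ μ : Measure (Pt X), IsProbabilityMeasure μ ∧ MeasurePreserving (shiftMap X) μ μ ∧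
      ∃ P C : ℝ, 1 ≤ C ∧ GibbsBound f P C μ := by
  obtain ⟨P, A, hA, hP⟩ := hr.exists_exp_bound hf
  obtain ⟨C, hC, hr⟩ := hr
  obtain ⟨C', hC', hl⟩ := hl
  have hB : 1 ≤ A * A * C :=
    one_le_mul_of_one_le_of_one_le (one_le_mul_of_one_le_of_one_le hA hA) hC
  set E := A * (A * A * C) * C' with hE
  have hE1 : 1 ≤ E := one_le_mul_of_one_le_of_one_le (one_le_mul_of_one_le_of_one_le hA hB) hC'
  have havg : ∀ m N : ℕ, 1 ≤ m → m < N → ∀ u ∈ words X m,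
      (averagedMeasure f N).real (cyl X u) ≤ E * (Real.exp (-(m * P)) * weight f u) ∧
        Real.exp (-(m * P)) * weight f u ≤ E * (averagedMeasure f N).real (cyl X u) := by
    intro m N hm hmN u hu
    have := isProbabilityMeasure_wordMeasure (X := X) hf (N := 2 * N) (by omega)
    have hN0 : (0 : ℝ) < N := by exact_mod_cast (by omega : 0 < N)
    have h : ∀ i ∈ Finset.range N, _ := fun i hi =>
      wordMeasure_preimage_gibbs hf hA hB hC' hP hl hm (Nat.succ_pos i)
        (fun w hw => wordMeasure_gibbs hf hA hC hP hr (N := 2 * N) (by omega)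
          (by have := Finset.mem_range.1 hi; omega) hw) hu
    rw [averagedMeasure_real hf (by omega) (measurableSet_cyl u), div_le_iff₀ hN0,
      mul_div_assoc', le_div_iff₀ hN0]
    constructor
    · refine (Finset.sum_le_sum fun i hi => (h i hi).1).trans ?_
      rw [Finset.sum_const, Finset.card_range, nsmul_eq_mul, mul_comm]
    · rw [Finset.mul_sum]
      refine le_trans ?_ (Finset.sum_le_sum fun i hi => (h i hi).2)
      rw [Finset.sum_const, Finset.card_range, nsmul_eq_mul, mul_comm]
  let p : ℕ → ProbabilityMeasure (Pt X) := fun N =>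
    ⟨averagedMeasure f (N + 1), isProbabilityMeasure_averagedMeasure hf (by omega)⟩
  -- A limit along an ultrafilter, by compactness of the space of probability measures.
  let U : Ultrafilter ℕ := hyperfilter ℕ
  obtain ⟨μ, hμ⟩ : ∃ μ : ProbabilityMeasure (Pt X), Tendsto p U (𝓝 μ) :=
    ⟨_, (U.map p).le_nhds_lim⟩
  have hU : (U : Filter ℕ) ≤ atTop := Nat.hyperfilter_le_atTop
  have hlim : ∀ s ∈ cylinderSets X, Tendsto (fun N => (averagedMeasure f (N + 1)).real s) U
      (𝓝 ((μ : Measure (Pt X)).real s)) := by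
    intro s hs
    have h0 : μ (frontier s) = 0 := by
      rw [(isClopen_of_mem_cylinderSets hs).frontier_eq]
      simp
    exact (NNReal.tendsto_coe.2
      (ProbabilityMeasure.tendsto_measure_of_null_frontier_of_tendsto hμ h0))
  refine ⟨μ, inferInstance, ⟨measurable_shiftMap, ?_⟩, P, E, hE1, fun m hm u hu => ?_⟩
  · have hinv : ∀ s ∈ cylinderSets X, (μ : Measure (Pt X)).real (shiftMap X ⁻¹' s) =
        (μ : Measure (Pt X)).real s := by
      intro s hs
      have h1 := (hlim _ (preimage_iterate_mem_cylinderSets hs 1)).sub (hlim s hs)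
      have h2 : Tendsto (fun N : ℕ => (1 : ℝ) / ((N + 1 : ℕ) : ℝ)) U (𝓝 0) := by
        have := (tendsto_one_div_add_atTop_nhds_zero_nat (𝕜 := ℝ)).mono_left hU
        simpa using this
      have h3 := squeeze_zero_norm (f := fun N => (averagedMeasure f (N + 1)).real
        (shiftMap X ⁻¹' s) - (averagedMeasure f (N + 1)).real s)
        (fun N => abs_averagedMeasure_sub_le (N := N + 1) hf (by omega)
          (measurableSet_of_mem_cylinderSets hs)) h2
      exact sub_eq_zero.1 (tendsto_nhds_unique h1 h3)
    have : IsFiniteMeasure ((μ : Measure (Pt X)).map (shiftMap X)) := inferInstance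
    refine ext_of_cylinderSets fun s hs => ?_
    rw [Measure.map_apply measurable_shiftMap (measurableSet_of_mem_cylinderSets hs)]
    exact (measureReal_eq_measureReal_iff).1 (hinv s hs)
  · have h1 := hlim _ (cyl_mem_cylinderSets u)
    have h2 : ∀ᶠ N in (U : Filter ℕ), m < N + 1 :=
      hU ((eventually_ge_atTop m).mono fun N hN => by omega)
    constructor
    · exact le_of_tendsto h1 (h2.mono fun N hN => (havg m _ hm hN u hu).1)
    · exact ge_of_tendsto (h1.const_mul E) (h2.mono fun N hN => (havg m _ hm hN u hu).2)

end

section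

variable {d : ℕ} {X : OneSidedSubshift d}

/-! ### Ergodicity of invariant Gibbs measures -/

/-- A lower mixing bound passes from cylinders to finite unions of cylinders. -/
theorem mixing_cylinderSets {k : ℕ} {μ : Measure (Pt X)} [IsFiniteMeasure μ] {D : ℝ}
    (h : ∀ m n : ℕ, 1 ≤ m → 1 ≤ n → ∀ u ∈ words X m, ∀ v ∈ words X n,
      μ.real (cyl X u) * μ.real (cyl X v) ≤
        D * μ.real (cyl X u ∩ (shiftMap X)^[m + k] ⁻¹' cyl X v))
    {A B : Set (Pt X)} (hA : A ∈ cylinderSets X) (hB : B ∈ cylinderSets X) :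
    ∃ N, μ.real A * μ.real B ≤ D * μ.real (A ∩ (shiftMap X)^[N] ⁻¹' B) := by
  classical
  obtain ⟨m, hm, S, rfl⟩ := exists_prefixWord_of_mem_cylinderSets hA
  obtain ⟨n, hn, T, rfl⟩ := exists_prefixWord_of_mem_cylinderSets hB
  have hset : prefixWord m ⁻¹' S ∩ (shiftMap X)^[m + k] ⁻¹' (prefixWord n ⁻¹' T) =
      ⋃ p ∈ ((words X m).filter (· ∈ S)) ×ˢ ((words X n).filter (· ∈ T)),
        cyl X p.1 ∩ (shiftMap X)^[m + k] ⁻¹' cyl X p.2 := by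
    ext x
    simp only [Set.mem_inter_iff, Set.mem_preimage, Finset.mem_product, Finset.mem_filter,
      Set.mem_iUnion, mem_cyl_iff, exists_prop, Prod.exists]
    constructor
    · exact fun hx => ⟨_, _, ⟨⟨prefixWord_mem_words _ _, hx.1⟩, prefixWord_mem_words _ _, hx.2⟩,
        rfl, rfl⟩
    · rintro ⟨_, _, ⟨⟨-, h1⟩, -, h2⟩, rfl, rfl⟩
      exact ⟨h1, h2⟩
  refine ⟨m + k, ?_⟩
  rw [hset, measureReal_biUnion_finset, measureReal_preimage_prefixWord μ m S,
    measureReal_preimage_prefixWord μ n T, Finset.sum_mul_sum, ← Finset.sum_product',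
    Finset.mul_sum]
  · refine Finset.sum_le_sum fun p hp => ?_
    simp only [Finset.mem_product, Finset.mem_filter] at hp
    exact h m n hm hn _ hp.1.1 _ hp.2.1
  · intro p _ q _ hpq
    rw [Function.onFun, Set.disjoint_left]
    rintro x ⟨h1, h2⟩ ⟨h3, h4⟩
    exact hpq (Prod.ext ((mem_cyl_iff.1 h1).symm.trans (mem_cyl_iff.1 h3))
      ((mem_cyl_iff.1 h2).symm.trans (mem_cyl_iff.1 h4)))
  · exact fun p _ => (measurableSet_cyl _).inter
      (measurable_shiftMap.iterate _ (measurableSet_cyl _))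

variable [Nonempty (Pt X)] {f : ℕ → Pt X → ℝ} {k : ℕ}

/-- The lower mixing bound for cylinders at distance `k`, from one connecting word. -/
theorem GibbsBound.exists_mixing_cyl (hf : IsContinuousSequence X f) (hsup : IsSuperadditive X f)
    (hbv : HasBoundedVariation X f) (hk : HasStrongSpecification X k) {μ : Measure (Pt X)}
    [IsFiniteMeasure μ] {P C : ℝ} (hC : 1 ≤ C) (h : GibbsBound f P C μ) :
    ∃ D : ℝ, 0 < D ∧ ∀ m n : ℕ, 1 ≤ m → 1 ≤ n → ∀ u ∈ words X m, ∀ v ∈ words X n,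
      μ.real (cyl X u) * μ.real (cyl X v) ≤
        D * μ.real (cyl X u ∩ (shiftMap X)^[m + k] ⁻¹' cyl X v) := by
  obtain ⟨M, hM, hMx⟩ := hbv.exists_weight_bound hf
  obtain ⟨D, hD, hext⟩ := exists_extend_left hf hsup hk.1
  obtain ⟨E, hE, hmul⟩ := hsup.exists_bound
  refine ⟨C * C * M * M * D * E * M * Real.exp (k * P) * C, by positivity,
    fun m n hm hn u hu v hv => ?_⟩
  obtain ⟨x, hxu, hxv⟩ := hk.exists_point hu hv
  have h1 := (h m hm u hu).1
  have h2 := (h n hn v hv).1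
  have h3 := (hMx m hm x).2
  rw [hxu] at h3
  have h4 := (hMx n hn ((shiftMap X)^[m + k] x)).2
  have h5 := hext n hn ((shiftMap X)^[m] x)
  rw [← Function.iterate_add_apply, Nat.add_comm k m] at h5
  rw [hxv] at h4
  have h6 := hmul m (k + n) hm (by omega) x
  have h7 := (hMx (m + (k + n)) (by omega) x).1
  have h8 := (h (m + (k + n)) (by omega) _ (prefixWord_mem_words _ x)).2
  have h9 : cyl X (prefixWord (m + (k + n)) x) ⊆
      cyl X u ∩ (shiftMap X)^[m + k] ⁻¹' cyl X v := by
    rw [← Nat.add_assoc, ← append_prefixWord, cyl_append, hxv]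
    refine Set.inter_subset_inter_left _ fun y hy => mem_cyl_iff.2 ?_
    rw [← hxu]
    exact prefixWord_eq_of_le (Nat.le_add_right m k) (mem_cyl_iff.1 hy)
  have h10 := measureReal_mono (μ := μ) h9
  have hexp : Real.exp (-(m * P)) * Real.exp (-(n * P)) =
      Real.exp (k * P) * Real.exp (-((m + (k + n) : ℕ) * P)) := by
    rw [← Real.exp_add, ← Real.exp_add]; congr 1; push_cast; ring
  have hfm := (hf m hm).2 x
  have hfn := (hf n hn).2 ((shiftMap X)^[m + k] x)
  calc μ.real (cyl X u) * μ.real (cyl X v)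
      ≤ (C * (Real.exp (-(m * P)) * (M * f m x))) *
        (C * (Real.exp (-(n * P)) * (M * (D * f (k + n) ((shiftMap X)^[m] x))))) := by
        refine mul_le_mul (h1.trans (by gcongr)) (h2.trans ?_) measureReal_nonneg (by positivity)
        gcongr
        exact h4.trans (by gcongr)
    _ = C * C * M * M * D * (Real.exp (-(m * P)) * Real.exp (-(n * P))) *
        (f m x * f (k + n) ((shiftMap X)^[m] x)) := by ring
    _ ≤ C * C * M * M * D * (Real.exp (k * P) * Real.exp (-((m + (k + n) : ℕ) * P))) *
        (E * (M * weight f (prefixWord (m + (k + n)) x))) := by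
        rw [hexp]
        exact mul_le_mul_of_nonneg_left (h6.trans (by gcongr)) (by positivity)
    _ = C * C * M * M * D * E * M * Real.exp (k * P) *
        (Real.exp (-((m + (k + n) : ℕ) * P)) * weight f (prefixWord (m + (k + n)) x)) := by ring
    _ ≤ C * C * M * M * D * E * M * Real.exp (k * P) *
        (C * μ.real (cyl X u ∩ (shiftMap X)^[m + k] ⁻¹' cyl X v)) :=
        mul_le_mul_of_nonneg_left (h8.trans (by gcongr)) (by positivity)
    _ = _ := by ring

theorem GibbsBound.ergodic (hf : IsContinuousSequence X f) (hsup : IsSuperadditive X f)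
    (hbv : HasBoundedVariation X f) (hk : HasStrongSpecification X k) {μ : Measure (Pt X)}
    [IsProbabilityMeasure μ] {P C : ℝ} (hC : 1 ≤ C) (h : GibbsBound f P C μ)
    (hμ : MeasurePreserving (shiftMap X) μ μ) : Ergodic (shiftMap X) μ := by
  obtain ⟨D, hD, hmix⟩ := h.exists_mixing_cyl hf hsup hbv hk hC
  refine ⟨hμ, ⟨fun {s} hs hinv => ?_⟩⟩
  have hpre : ∀ N, (shiftMap X)^[N] ⁻¹' s = s := fun N => by
    induction N with
    | zero => rfl
    | succ N ih => rw [Function.iterate_succ, Set.preimage_comp, ih, hinv]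
  have key : ∀ ε : ℝ, 0 < ε → μ.real s * (1 - μ.real s) ≤ (2 * D + 1) * ε := by
    intro ε hε
    obtain ⟨t, ht, hst⟩ := exists_cylinderSet_approx μ hs hε
    have htm := measurableSet_of_mem_cylinderSets ht
    obtain ⟨N, hN⟩ := mixing_cylinderSets hmix (isSetAlgebra_cylinderSets.compl_mem ht) ht
    rw [probReal_compl_eq_one_sub htm] at hN
    -- As `s` is invariant, `tᶜ ∩ σ⁻ᴺ t` lies in the union of `s ∆ t` and `σ⁻ᴺ (s ∆ t)`.
    have h1 : tᶜ ∩ (shiftMap X)^[N] ⁻¹' t ⊆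
        symmDiff s t ∪ (shiftMap X)^[N] ⁻¹' (symmDiff s t) := by
      rintro x ⟨hx1, hx2⟩
      by_cases hxs : x ∈ s
      · exact Or.inl (Or.inl ⟨hxs, hx1⟩)
      · refine Or.inr (Or.inr ⟨hx2, fun h => hxs ?_⟩)
        rw [← hpre N]
        exact h
    have h2 : μ.real ((shiftMap X)^[N] ⁻¹' (symmDiff s t)) = μ.real (symmDiff s t) :=
      (hμ.iterate N).measureReal_preimage (hs.symmDiff htm).nullMeasurableSet
    have h3 := (measureReal_mono (μ := μ) h1).trans (measureReal_union_le _ _)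
    have h4 : |μ.real s - μ.real t| ≤ μ.real (symmDiff s t) :=
      abs_measureReal_sub_le_measureReal_symmDiff hs.nullMeasurableSet
        htm.nullMeasurableSet
    have h5 : (1 - μ.real t) * μ.real t ≤ D * (2 * ε) :=
      hN.trans (mul_le_mul_of_nonneg_left (by linarith) hD.le)
    have hs0 := measureReal_nonneg (μ := μ) (s := s)
    have ht0 := measureReal_nonneg (μ := μ) (s := t)
    have hs1 := measureReal_le_one (μ := μ) (s := s)
    have ht1 := measureReal_le_one (μ := μ) (s := t)
    have h6 := abs_le.1 (h4.trans hst.le)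
    have h7 : (μ.real s - μ.real t) * (1 - μ.real s - μ.real t) ≤ ε := by
      refine (le_abs_self _).trans ?_
      rw [abs_mul]
      calc |μ.real s - μ.real t| * |1 - μ.real s - μ.real t| ≤ ε * 1 := by
            refine mul_le_mul (h4.trans hst.le) ?_ (abs_nonneg _) hε.le
            rw [abs_le]; constructor <;> linarith
        _ = ε := mul_one ε
    nlinarith
  have h0 : μ.real s * (1 - μ.real s) ≤ 0 := by
    refine le_of_forall_pos_le_add fun ε hε => ?_
    have := key (ε / (2 * D + 1)) (by positivity)
    rwa [mul_div_cancel₀ _ (by positivity), ← zero_add ε] at this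
  have hs0 := measureReal_nonneg (μ := μ) (s := s)
  have hs1 := measureReal_le_one (μ := μ) (s := s)
  have h01 : μ.real s = 0 ∨ μ.real s = 1 := by
    have : μ.real s * (1 - μ.real s) = 0 := le_antisymm h0 (mul_nonneg hs0 (by linarith))
    rcases mul_eq_zero.1 this with h | h
    · exact Or.inl h
    · exact Or.inr (by linarith)
  rw [eventuallyConst_set]
  rcases h01 with h | h
  · exact Or.inr (measure_eq_zero_iff_ae_notMem.1 ((measureReal_eq_zero_iff).1 h))
  · left
    have h' : μ.real sᶜ = 0 := by rw [probReal_compl_eq_one_sub hs, h, sub_self]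
    filter_upwards [measure_eq_zero_iff_ae_notMem.1 ((measureReal_eq_zero_iff).1 h')] with x hx
    exact not_not.1 hx

/-! ### Uniqueness of the ergodic Gibbs measure -/

theorem GibbsBound.exponent_le {μ ν : Measure (Pt X)} [IsProbabilityMeasure μ]
    [IsProbabilityMeasure ν] {P Q C D : ℝ} (hC : 1 ≤ C) (hD : 1 ≤ D) (h : GibbsBound f P C μ)
    (h' : GibbsBound f Q D ν) : P ≤ Q := by
  by_contra! hlt
  obtain ⟨n, hn⟩ := exists_nat_gt (Real.log (C * D) / (P - Q))
  rw [div_lt_iff₀ (by linarith)] at hn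
  have hlog : 0 ≤ Real.log (C * D) := Real.log_nonneg (one_le_mul_of_one_le_of_one_le hC hD)
  have hn1 : 1 ≤ n := by
    rcases Nat.eq_zero_or_pos n with rfl | h
    · simp only [Nat.cast_zero, zero_mul] at hn
      linarith
    · exact h
  have h1 := (h.weightSum_bound hn1).1
  have h2 := (h'.weightSum_bound hn1).2
  have h3 : 1 ≤ C * D * Real.exp (n * (Q - P)) := by
    have hexp : Real.exp (-(n * P)) = Real.exp (n * (Q - P)) * Real.exp (-(n * Q)) := by
      rw [← Real.exp_add]; congr 1; ring
    calc 1 ≤ C * (Real.exp (-(n * P)) * weightSum f n) := h1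
      _ = C * Real.exp (n * (Q - P)) * (Real.exp (-(n * Q)) * weightSum f n) := by
        rw [hexp]; ring
      _ ≤ C * Real.exp (n * (Q - P)) * D := by gcongr
      _ = _ := by ring
  have h4 := Real.log_le_log one_pos h3
  rw [Real.log_one, Real.log_mul (by positivity) (Real.exp_pos _).ne', Real.log_exp] at h4
  linarith [show (n : ℝ) * (Q - P) = -(n * (P - Q)) by ring]

theorem IsErgodicGibbs.unique (hf : IsContinuousSequence X f) {μ ν : Measure (Pt X)}
    (hμ : IsErgodicGibbs X f μ) (hν : IsErgodicGibbs X f ν) : μ = ν := by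
  have := hμ.1.1
  have := hν.1.1
  obtain ⟨-, P, C, hC, hP⟩ := hμ.1.exists_gibbsBound hf
  obtain ⟨-, Q, D, hD, hQ⟩ := hν.1.exists_gibbsBound hf
  obtain rfl : P = Q := le_antisymm (hP.exponent_le hC hD hQ) (hQ.exponent_le hD hC hP)
  refine hν.2.eq_of_absolutelyContinuous hμ.2.toMeasurePreserving
    (absolutelyContinuous_of_cyl_le (D := C * D) (by positivity) fun n hn u hu => ?_)
  calc μ.real (cyl X u) ≤ C * (Real.exp (-(n * P)) * weight f u) := (hP n hn u hu).1
    _ ≤ C * (D * ν.real (cyl X u)) :=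
      mul_le_mul_of_nonneg_left (hQ n hn u hu).2 (by positivity)
    _ = _ := by ring

/-- Balance yields exactly one invariant ergodic Gibbs measure. -/
theorem Balanced.existsUnique (hf : IsContinuousSequence X f) (hsup : IsSuperadditive X f)
    (hk : HasStrongSpecification X k) (h : Balanced X f) :
    ∃! μ : Measure (Pt X), IsErgodicGibbs X f μ := by
  have hbv := ((rightBalanced_iff hf).1 h.1).1
  obtain ⟨μ, hμ, hinv, P, C, hC, hg⟩ := exists_invariant_gibbsBound hf
    (h.1.sumBalanced hf hsup hk) (h.2.sumBalanced hf hsup hk)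
  exact ⟨μ, ⟨hg.isGibbs hf hbv hC, hg.ergodic hf hsup hbv hk hC hinv⟩,
    fun ν hν => hν.unique hf ⟨hg.isGibbs hf hbv hC, hg.ergodic hf hsup hbv hk hC hinv⟩⟩

end

section

/-! ### Shannon entropy -/

section Shannon

variable {Ω ι : Type*} [MeasurableSpace Ω] [Fintype ι] [MeasurableSpace ι]
  [MeasurableSingletonClass ι] {μ : Measure Ω} [IsProbabilityMeasure μ] {φ : Ω → ι}

theorem integrable_comp_of_finite (hφ : Measurable φ) (F : ι → ℝ) :
    Integrable (fun x => F (φ x)) μ :=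
  (Integrable.of_finite (μ := μ.map φ) (f := F)).comp_measurable hφ

theorem integral_comp_of_finite (hφ : Measurable φ) (F : ι → ℝ) :
    ∫ x, F (φ x) ∂μ = ∑ i, μ.real (φ ⁻¹' {i}) * F i := by
  have : IsProbabilityMeasure (μ.map φ) := Measure.isProbabilityMeasure_map hφ.aemeasurable
  rw [← integral_map (f := F) hφ.aemeasurable Integrable.of_finite.aestronglyMeasurable,
    integral_fintype Integrable.of_finite]
  simp only [map_measureReal_apply hφ (measurableSet_singleton _), smul_eq_mul]

theorem shannonEntropy_eq_integral (hφ : Measurable φ) :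
    shannonEntropy μ φ = ∫ x, -Real.log (μ.real (φ ⁻¹' {φ x})) ∂μ := by
  rw [integral_comp_of_finite hφ fun i => -Real.log (μ.real (φ ⁻¹' {i})), shannonEntropy]
  simp [Real.negMulLog]

/-- The Gibbs inequality: the entropy is at most the mean code length of any code whose lengths
satisfy Kraft's inequality. -/
theorem shannonEntropy_le_integral (hφ : Measurable φ) {q : ι → ℝ} (hq : ∀ i, 0 ≤ q i)
    (hq1 : ∑ i, q i ≤ 1) {g : Ω → ℝ} (hg : Integrable g μ)
    (h : ∀ x, Real.exp (-g x) ≤ q (φ x)) : shannonEntropy μ φ ≤ ∫ x, g x ∂μ := by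
  have hpos : ∀ x, 0 < q (φ x) := fun x => (Real.exp_pos _).trans_le (h x)
  have h1 : ∫ x, -Real.log (q (φ x)) ∂μ ≤ ∫ x, g x ∂μ := by
    refine integral_mono (integrable_comp_of_finite hφ fun i => -Real.log (q i)) hg fun x => ?_
    have := (Real.le_log_iff_exp_le (hpos x)).2 (h x)
    linarith
  refine le_trans ?_ h1
  have hsum : ∑ i, μ.real (φ ⁻¹' {i}) = 1 := by
    have := integral_comp_of_finite (μ := μ) hφ fun _ => (1 : ℝ)
    simpa using this.symm
  rw [integral_comp_of_finite hφ fun i => -Real.log (q i), shannonEntropy, ← sub_nonpos,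
    ← Finset.sum_sub_distrib]
  calc ∑ i, (Real.negMulLog (μ.real (φ ⁻¹' {i})) - μ.real (φ ⁻¹' {i}) * -Real.log (q i))
      ≤ ∑ i, (q i - μ.real (φ ⁻¹' {i})) := by
        refine Finset.sum_le_sum fun i _ => ?_
        rcases (measureReal_nonneg (μ := μ) (s := φ ⁻¹' {i})).eq_or_lt with h0 | h0
        · rw [← h0]
          simpa using hq i
        · obtain ⟨x, rfl⟩ : ∃ x, φ x = i := by
            by_contra! hne
            have hempty : φ ⁻¹' {i} = ∅ := Set.eq_empty_of_forall_notMem fun x hx => hne x hx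
            rw [hempty] at h0
            simp at h0
          have h2 := Real.log_le_sub_one_of_pos (div_pos (hpos x) h0)
          rw [Real.log_div (hpos x).ne' h0.ne'] at h2
          have h3 := mul_le_mul_of_nonneg_left h2 h0.le
          rw [mul_sub, mul_sub, mul_div_cancel₀ _ h0.ne', mul_one] at h3
          rw [Real.negMulLog]
          linarith
    _ ≤ 0 := by
      rw [Finset.sum_sub_distrib, hsum]
      linarith

end Shannon

variable {d : ℕ} {X : OneSidedSubshift d}

/-! ### The asymptotic average -/

theorem IsContinuousSequence.integrable_log {f : ℕ → Pt X → ℝ} (hf : IsContinuousSequence X f)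
    (μ : Measure (Pt X)) [IsFiniteMeasure μ] {n : ℕ} (hn : 1 ≤ n) :
    Integrable (fun x => Real.log (f n x)) μ :=
  ((hf n hn).1.log fun x => ((hf n hn).2 x).ne').integrable_of_hasCompactSupport
    (HasCompactSupport.of_compactSpace _)

theorem integral_log_add_le {f : ℕ → Pt X → ℝ} (hf : IsContinuousSequence X f) {C : ℝ}
    (hC : ∀ m n, 1 ≤ m → 1 ≤ n → ∀ x : Pt X,
      Real.exp (-C) * f m x * f n ((shiftMap X)^[m] x) ≤ f (m + n) x)
    {μ : Measure (Pt X)} (hμ : μ ∈ invariantMeasures X) {m n : ℕ} (hm : 1 ≤ m) (hn : 1 ≤ n) :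
    ∫ x, Real.log (f m x) ∂μ + ∫ x, Real.log (f n x) ∂μ - C ≤ ∫ x, Real.log (f (m + n) x) ∂μ := by
  obtain ⟨_, hinv⟩ := hμ
  have hi := (hinv.iterate m)
  have hcomp : ∫ x, Real.log (f n ((shiftMap X)^[m] x)) ∂μ = ∫ x, Real.log (f n x) ∂μ := by
    conv_rhs => rw [← hi.map_eq]
    rw [integral_map hi.measurable.aemeasurable]
    rw [hi.map_eq]
    exact (hf.integrable_log μ hn).aestronglyMeasurable
  have hint : Integrable (fun x => Real.log (f n ((shiftMap X)^[m] x))) μ :=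
    hi.integrable_comp_of_integrable (hf.integrable_log μ hn)
  have hint' : Integrable (fun x => Real.log (f m x) + Real.log (f n ((shiftMap X)^[m] x))) μ :=
    (hf.integrable_log μ hm).add hint
  rw [← hcomp, ← integral_add (hf.integrable_log μ hm) hint]
  have hconst : C = ∫ _, C ∂μ := by simp
  nth_rw 1 [hconst]
  rw [← integral_sub hint' (integrable_const C)]
  refine integral_mono (hint'.sub (integrable_const C)) (hf.integrable_log μ (by omega))
    fun x => ?_
  have h1 := (hf m hm).2 x
  have h2 := (hf n hn).2 ((shiftMap X)^[m] x)
  have h3 := Real.log_le_log (by positivity) (hC m n hm hn x)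
  rw [Real.log_mul (by positivity) h2.ne', Real.log_mul (Real.exp_pos _).ne' h1.ne',
    Real.log_exp] at h3
  linarith

variable [Nonempty (Pt X)] {f : ℕ → Pt X → ℝ} {k : ℕ}

/-- The averages `(1/n) ∫ log f_n dμ` converge: they are superadditive up to a constant, and
bounded above by the growth of `weightSum`. -/
theorem exists_tendsto_average (hf : IsContinuousSequence X f) (hsup : IsSuperadditive X f)
    (hbv : HasBoundedVariation X f) {P A : ℝ}
    (hP : ∀ n : ℕ, 1 ≤ n → weightSum f n ≤ A * Real.exp (n * P))
    {μ : Measure (Pt X)} (hμ : μ ∈ invariantMeasures X) :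
    ∃ L : ℝ, Tendsto (fun n : ℕ => 1 / (n : ℝ) * ∫ x, Real.log (f n x) ∂μ) atTop (𝓝 L) := by
  obtain ⟨C, hC, hadd⟩ := hsup
  obtain ⟨M, hM, hMx⟩ := hbv.exists_weight_bound hf
  have hA : 0 < A := pos_of_mul_pos_left
    ((hf.weightSum_pos (X := X) le_rfl).trans_le (hP 1 le_rfl)) (Real.exp_pos _).le
  have hprob := hμ.1
  have hupper : ∀ n : ℕ, 1 ≤ n → ∫ x, Real.log (f n x) ∂μ ≤ Real.log (M * A) + n * P := by
    intro n hn
    have : Real.log (M * A) + n * P = ∫ _, (Real.log (M * A) + n * P) ∂μ := by simp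
    rw [this]
    refine integral_mono (hf.integrable_log μ hn) (integrable_const _) fun x => ?_
    have h1 : f n x ≤ M * A * Real.exp (n * P) := by
      rw [mul_assoc]
      refine (hMx n hn x).1.trans (mul_le_mul_of_nonneg_left (le_trans ?_ (hP n hn))
        (by positivity))
      exact Finset.single_le_sum (f := fun u => weight f u)
        (fun u _ => (hf.weight_pos hn u).le) (prefixWord_mem_words n x)
    have h2 := Real.log_le_log ((hf n hn).2 x) h1
    rwa [Real.log_mul (by positivity) (Real.exp_pos _).ne', Real.log_exp] at h2
  set u : ℕ → ℝ := fun n => if n = 0 then 0 else C - ∫ x, Real.log (f n x) ∂μ with hu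
  have hus : Subadditive u := by
    intro m n
    rcases Nat.eq_zero_or_pos m with rfl | hm
    · simp [hu]
    rcases Nat.eq_zero_or_pos n with rfl | hn
    · simp [hu]
    have := integral_log_add_le hf hadd hμ hm hn
    simp only [hu, show m + n ≠ 0 by omega, hm.ne', hn.ne', if_false]
    linarith
  have hub : BddBelow (Set.range fun n => u n / n) := by
    refine ⟨-(|Real.log (M * A)| + |P|), ?_⟩
    rintro _ ⟨n, rfl⟩
    rcases Nat.eq_zero_or_pos n with rfl | hn
    · simp only [Nat.cast_zero, div_zero]
      linarith [abs_nonneg P, abs_nonneg (Real.log (M * A))]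
    have hn' : (1 : ℝ) ≤ n := Nat.one_le_cast.2 hn
    simp only [hu, hn.ne', if_false]
    rw [le_div_iff₀ (by linarith)]
    have := hupper n hn
    nlinarith [le_abs_self P, le_abs_self (Real.log (M * A)), abs_nonneg (Real.log (M * A))]
  refine ⟨-hus.lim, ?_⟩
  have h1 := (tendsto_const_div_atTop_nhds_zero_nat C).sub (hus.tendsto_lim hub)
  rw [zero_sub] at h1
  refine h1.congr' ?_
  filter_upwards [eventually_ge_atTop 1] with n hn
  simp only [hu, show n ≠ 0 by omega, if_false]
  ring

/-! ### The upper bound in the variational principle -/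

/-- Approximation of a finite measurable partition by a partition into cylinder sets. -/
theorem exists_partition_approx (μ : Measure (Pt X)) [IsFiniteMeasure μ] {r : ℕ}
    {ξ : Pt X → Fin r} (hξ : Measurable ξ) {ε : ℝ} (hε : 0 < ε) :
    ∃ (N : ℕ) (η : (Fin N → Fin d) → Fin r), μ.real {x | η (prefixWord N x) ≠ ξ x} ≤ ε := by
  classical
  have hr : Nonempty (Fin r) := ⟨ξ (Classical.arbitrary _)⟩
  have hr0 : (0 : ℝ) < r := by exact_mod_cast Fin.pos_iff_nonempty.2 hr
  have h := fun a : Fin r => exists_cylinderSet_approx μ (hξ (measurableSet_singleton a))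
    (ε := ε / r) (by positivity)
  choose t ht hta using h
  choose n S hS using ht
  set N := Finset.univ.sup n with hN
  have hnN : ∀ a, n a ≤ N := fun a => Finset.le_sup (Finset.mem_univ a)
  have ht' : ∀ a, ∃ T : Set (Fin N → Fin d), t a = prefixWord N ⁻¹' T := fun a =>
    ⟨_, (hS a).trans (preimage_prefixWord_of_le (hnN a) (S a))⟩
  choose T hT using ht'
  refine ⟨N, fun w => Classical.epsilon fun a => w ∈ T a, ?_⟩
  have hsub : {x : Pt X | Classical.epsilon (fun a => prefixWord N x ∈ T a) ≠ ξ x} ⊆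
      ⋃ a ∈ (Finset.univ : Finset (Fin r)), symmDiff (ξ ⁻¹' {a}) (t a) := by
    intro x hx
    by_contra hcon
    simp only [Finset.mem_univ, Set.iUnion_true, Set.mem_iUnion, not_exists] at hcon
    have hiff : ∀ a, prefixWord N x ∈ T a ↔ ξ x = a := fun a => by
      have h1 := hcon a
      rw [Set.mem_symmDiff, hT a] at h1
      simp only [Set.mem_preimage, Set.mem_singleton_iff] at h1
      tauto
    have := Classical.epsilon_spec (p := fun a => prefixWord N x ∈ T a) ⟨ξ x, (hiff _).2 rfl⟩
    exact hx ((hiff _).1 this).symm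
  calc _ ≤ _ := measureReal_mono hsub (measure_ne_top μ _)
    _ ≤ ∑ a : Fin r, μ.real (symmDiff (ξ ⁻¹' {a}) (t a)) := measureReal_biUnion_finset_le _ _
    _ ≤ ∑ _ : Fin r, ε / r := Finset.sum_le_sum fun a _ => (hta a).le
    _ = ε := by simp [mul_div_cancel₀ ε hr0.ne']

/-- The entropy of an itinerary is bounded by the mean length of the following code: a word of
length `n + N` is coded by its share of `weightSum`, and then each letter of the itinerary is coded
given the corresponding subword of length `N`. -/
theorem shannonEntropy_itinerary_le (hf : IsContinuousSequence X f) {M : ℝ} (hM : 1 ≤ M)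
    (hMx : ∀ n, 1 ≤ n → ∀ x : Pt X,
      f n x ≤ M * weight f (prefixWord n x) ∧ weight f (prefixWord n x) ≤ M * f n x)
    {μ : Measure (Pt X)} (hμ : μ ∈ invariantMeasures X) {r N : ℕ} {ξ : Pt X → Fin r}
    (hξ : Measurable ξ) {Q : Fin r → (Fin N → Fin d) → ℝ} (hQ0 : ∀ a w, 0 ≤ Q a w)
    (hQ1 : ∀ w, ∑ a, Q a w ≤ 1) {l : Pt X → ℝ} (hl : Integrable l μ)
    (hlQ : ∀ x, Real.exp (-l x) ≤ Q (ξ x) (prefixWord N x)) {n : ℕ} (hn : 1 ≤ n) :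
    shannonEntropy μ (itinerary (shiftMap X) ξ n) ≤
      Real.log (weightSum f (n + N)) + Real.log M - ∫ x, Real.log (f (n + N) x) ∂μ +
        n * ∫ x, l x ∂μ := by
  obtain ⟨_, hinv⟩ := hμ
  have hZ := hf.weightSum_pos (X := X) (n := n + N) (by omega)
  have hit : Measurable (itinerary (shiftMap X) ξ n) :=
    measurable_pi_lambda _ fun i => hξ.comp (measurable_shiftMap.iterate _)
  let sub : (Fin (n + N) → Fin d) → Fin n → Fin N → Fin d := fun w i j => w ⟨i + j, by omega⟩
  have hsub : ∀ x i, sub (prefixWord (n + N) x) i = prefixWord N ((shiftMap X)^[i] x) := by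
    intro x i
    funext j
    simp [sub, prefixWord, shiftMap_iterate_apply]
  let q : (Fin n → Fin r) → ℝ := fun a =>
    ∑ w ∈ words X (n + N), weight f w / weightSum f (n + N) * ∏ i, Q (a i) (sub w i)
  have hterm : ∀ (a : Fin n → Fin r) (w : Fin (n + N) → Fin d),
      0 ≤ weight f w / weightSum f (n + N) * ∏ i, Q (a i) (sub w i) := fun a w =>
    mul_nonneg (div_nonneg (hf.weight_pos (by omega) w).le hZ.le)
      (Finset.prod_nonneg fun i _ => hQ0 _ _)
  have hq0 : ∀ a, 0 ≤ q a := fun a => Finset.sum_nonneg fun w _ => hterm a w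
  have hq1 : ∑ a, q a ≤ 1 := by
    simp only [q]
    rw [Finset.sum_comm]
    calc ∑ w ∈ words X (n + N), ∑ a : Fin n → Fin r,
          weight f w / weightSum f (n + N) * ∏ i, Q (a i) (sub w i)
        ≤ ∑ w ∈ words X (n + N), weight f w / weightSum f (n + N) := by
          refine Finset.sum_le_sum fun w _ => ?_
          rw [← Finset.mul_sum]
          refine mul_le_of_le_one_right
            (div_nonneg (hf.weight_pos (by omega) w).le hZ.le) ?_
          have := (Fintype.prod_sum fun (i : Fin n) (a : Fin r) => Q a (sub w i)).symm
          rw [this]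
          exact Finset.prod_le_one (fun i _ => Finset.sum_nonneg fun a _ => hQ0 _ _)
            fun i _ => hQ1 _
      _ = 1 := by rw [← Finset.sum_div, ← weightSum, div_self hZ.ne']
  have hli : ∀ i : ℕ, Integrable (fun x => l ((shiftMap X)^[i] x)) μ := fun i =>
    (hinv.iterate i).integrable_comp_of_integrable hl
  have hint : ∀ i : ℕ, ∫ x, l ((shiftMap X)^[i] x) ∂μ = ∫ x, l x ∂μ := fun i => by
    conv_rhs => rw [← (hinv.iterate i).map_eq]
    rw [integral_map (hinv.iterate i).measurable.aemeasurable]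
    rw [(hinv.iterate i).map_eq]
    exact hl.aestronglyMeasurable
  have hfi := hf.integrable_log μ (n := n + N) (by omega)
  have hc : Integrable (fun x => Real.log (weightSum f (n + N)) + Real.log M -
      Real.log (f (n + N) x)) μ := (integrable_const _).sub hfi
  have hs : Integrable (fun x => ∑ i : Fin n, l ((shiftMap X)^[i] x)) μ :=
    integrable_finsetSum _ fun i _ => hli i
  have key := shannonEntropy_le_integral (μ := μ) hit hq0 hq1 (hc.add hs) fun x => by
    have h1 := (hMx (n + N) (by omega) x).1
    have hfx := (hf (n + N) (by omega)).2 x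
    simp only [Pi.add_apply]
    calc Real.exp (-(Real.log (weightSum f (n + N)) + Real.log M - Real.log (f (n + N) x) +
          ∑ i : Fin n, l ((shiftMap X)^[i] x)))
        = f (n + N) x / (M * weightSum f (n + N)) *
            ∏ i : Fin n, Real.exp (-l ((shiftMap X)^[i] x)) := by
          rw [← Real.exp_sum, Finset.sum_neg_distrib, neg_add, Real.exp_add]
          congr 1
          rw [neg_sub, Real.exp_sub, Real.exp_add, Real.exp_log hfx, Real.exp_log hZ,
            Real.exp_log (by linarith), mul_comm M]
      _ ≤ weight f (prefixWord (n + N) x) / weightSum f (n + N) *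
            ∏ i : Fin n, Q (itinerary (shiftMap X) ξ n x i) (sub (prefixWord (n + N) x) i) := by
          refine mul_le_mul ?_ (Finset.prod_le_prod (fun i _ => (Real.exp_pos _).le) fun i _ => ?_)
            (Finset.prod_nonneg fun i _ => (Real.exp_pos _).le)
            (div_nonneg (hf.weight_pos (by omega) _).le hZ.le)
          · rw [div_le_div_iff₀ (by positivity) hZ]
            calc f (n + N) x * weightSum f (n + N)
                ≤ (M * weight f (prefixWord (n + N) x)) * weightSum f (n + N) := by gcongr
              _ = _ := by ring
          · rw [hsub]
            exact hlQ _
      _ ≤ q (itinerary (shiftMap X) ξ n x) :=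
        Finset.single_le_sum (f := fun w => weight f w / weightSum f (n + N) *
            ∏ i, Q (itinerary (shiftMap X) ξ n x i) (sub w i))
          (fun w _ => hterm _ w) (prefixWord_mem_words _ x)
  refine key.trans (le_of_eq ?_)
  simp only [Pi.add_apply]
  rw [integral_add hc hs, integral_sub (integrable_const _) hfi,
    integral_finsetSum (f := fun (i : Fin n) x => l ((shiftMap X)^[i] x)) _ fun i _ => hli i]
  simp [hint]

theorem exists_shannonEntropy_itinerary_le (hf : IsContinuousSequence X f) {M : ℝ} (hM : 1 ≤ M)
    (hMx : ∀ n, 1 ≤ n → ∀ x : Pt X,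
      f n x ≤ M * weight f (prefixWord n x) ∧ weight f (prefixWord n x) ≤ M * f n x)
    {μ : Measure (Pt X)} (hμ : μ ∈ invariantMeasures X) {r : ℕ} {ξ : Pt X → Fin r}
    (hξ : Measurable ξ) {δ : ℝ} (hδ : 0 < δ) :
    ∃ N : ℕ, ∀ n : ℕ, 1 ≤ n → shannonEntropy μ (itinerary (shiftMap X) ξ n) ≤
      Real.log (weightSum f (n + N)) + Real.log M - ∫ x, Real.log (f (n + N) x) ∂μ + n * δ := by
  have hprob := hμ.1
  have hr : 0 < r := Fin.pos_iff_nonempty.2 ⟨ξ (Classical.arbitrary _)⟩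
  have hr0 : (1 : ℝ) ≤ r := by exact_mod_cast hr
  -- The predicted letter is coded with length `δ / 2`, every other letter with length `-log β`.
  have he1 : Real.exp (-(δ / 2)) < 1 := Real.exp_lt_one_iff.2 (by linarith)
  set β := (1 - Real.exp (-(δ / 2))) / r with hβ
  have hβ0 : 0 < β := div_pos (by linarith) (by linarith)
  have hβ1 : β ≤ 1 := (div_le_one (by linarith)).2 (by linarith [Real.exp_pos (-(δ / 2))])
  have hlogβ : 0 ≤ -Real.log β := by linarith [Real.log_nonpos hβ0.le hβ1]
  obtain ⟨N, η, hη⟩ := exists_partition_approx μ hξ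
    (ε := δ / 2 / (-Real.log β + 1)) (by positivity)
  set s := {x : Pt X | η (prefixWord N x) ≠ ξ x} with hs
  have hsm : MeasurableSet s := by
    have : Measurable fun x : Pt X => η (prefixWord N x) :=
      (measurable_of_finite η).comp (measurable_prefixWord N)
    exact (measurableSet_eq_fun this hξ).compl
  refine ⟨N, fun n hn => ?_⟩
  refine (shannonEntropy_itinerary_le hf hM hMx hμ hξ
    (Q := fun a w => if η w = a then Real.exp (-(δ / 2)) else β)
    (l := fun x => δ / 2 + s.indicator (fun _ => -Real.log β) x)
    (fun a w => by split_ifs <;> positivity) (fun w => ?_)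
    ((integrable_const _).add ((integrable_const _).indicator hsm)) (fun x => ?_) hn).trans ?_
  · calc ∑ a, (if η w = a then Real.exp (-(δ / 2)) else β)
        ≤ ∑ a, ((if η w = a then Real.exp (-(δ / 2)) else 0) + β) := by
          refine Finset.sum_le_sum fun a _ => ?_
          split_ifs <;> linarith
      _ = Real.exp (-(δ / 2)) + r * β := by
        rw [Finset.sum_add_distrib, Finset.sum_ite_eq]
        simp
      _ = 1 := by rw [hβ, mul_div_cancel₀ _ (by linarith)]; ring
  · by_cases hx : x ∈ s
    · have hx' : η (prefixWord N x) ≠ ξ x := hx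
      simp only [Set.indicator_of_mem hx, if_neg hx']
      rw [← Real.le_log_iff_exp_le hβ0]
      linarith
    · have hx' : η (prefixWord N x) = ξ x := not_not.1 hx
      simp only [Set.indicator_of_notMem hx, if_pos hx', add_zero, le_refl]
  · have h1 : ∫ x, (δ / 2 + s.indicator (fun _ => -Real.log β) x) ∂μ ≤ δ := by
      rw [integral_add (integrable_const _) ((integrable_const _).indicator hsm),
        integral_indicator_const _ hsm]
      simp only [integral_const, probReal_univ, smul_eq_mul, one_mul]
      have h2 : μ.real s * (-Real.log β) ≤ δ / 2 / (-Real.log β + 1) * (-Real.log β + 1) :=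
        mul_le_mul hη (by linarith) hlogβ (by positivity)
      rw [div_mul_cancel₀ _ (by linarith : -Real.log β + 1 ≠ 0)] at h2
      linarith
    gcongr

/-- If `b_n / n` converges, then `b_{n+N} / n` has the same limit. -/
theorem tendsto_div_shift {b : ℕ → ℝ} {L : ℝ}
    (h : Tendsto (fun n : ℕ => 1 / (n : ℝ) * b n) atTop (𝓝 L)) (N : ℕ) :
    Tendsto (fun n : ℕ => 1 / (n : ℝ) * b (n + N)) atTop (𝓝 L) := by
  have h1 := (h.comp (tendsto_add_atTop_nat N))
  have h2 : Tendsto (fun n : ℕ => 1 + (N : ℝ) / n) atTop (𝓝 (1 + 0)) :=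
    tendsto_const_nhds.add (tendsto_const_div_atTop_nhds_zero_nat _)
  have h3 := h2.mul h1
  rw [add_zero, one_mul] at h3
  refine h3.congr' ?_
  filter_upwards [eventually_ge_atTop 1] with n hn
  have hn' : (n : ℝ) ≠ 0 := by exact_mod_cast (by omega : n ≠ 0)
  have hn2 : ((n : ℝ) + N) ≠ 0 := by positivity
  simp only [Function.comp]
  push_cast
  field_simp

theorem tendsto_log_weightSum (hf : IsContinuousSequence X f) {P A : ℝ} (hA : 1 ≤ A)
    (hP : ∀ n : ℕ, 1 ≤ n →
      weightSum f n ≤ A * Real.exp (n * P) ∧ Real.exp (n * P) ≤ A * weightSum f n)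
    {g : ℕ → ℝ} {B : ℝ} (hB : 1 ≤ B)
    (hg : ∀ n, 1 ≤ n → weightSum f n ≤ g n ∧ g n ≤ B * weightSum f n) :
    Tendsto (fun n : ℕ => 1 / (n : ℝ) * Real.log (g n)) atTop (𝓝 P) := by
  have hlim : Tendsto (fun n : ℕ => Real.log (A * B) / (n : ℝ)) atTop (𝓝 0) :=
    tendsto_const_div_atTop_nhds_zero_nat _
  have hlow : Tendsto (fun n : ℕ => P - Real.log (A * B) / (n : ℝ)) atTop (𝓝 P) := by
    simpa using tendsto_const_nhds.sub hlim
  have hupp : Tendsto (fun n : ℕ => P + Real.log (A * B) / (n : ℝ)) atTop (𝓝 P) := by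
    simpa using tendsto_const_nhds.add hlim
  have hbound : ∀ n : ℕ, 1 ≤ n → |Real.log (g n) - n * P| ≤ Real.log (A * B) := by
    intro n hn
    have hZ := hf.weightSum_pos (X := X) hn
    have hg0 : 0 < g n := hZ.trans_le (hg n hn).1
    have h1 : g n ≤ A * B * Real.exp (n * P) := by
      calc g n ≤ B * (A * Real.exp (n * P)) :=
            (hg n hn).2.trans (mul_le_mul_of_nonneg_left (hP n hn).1 (by linarith))
        _ = _ := by ring
    have h2 : Real.exp (n * P) ≤ A * B * g n := by
      calc Real.exp (n * P) ≤ A * g n :=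
            (hP n hn).2.trans (mul_le_mul_of_nonneg_left (hg n hn).1 (by linarith))
        _ ≤ A * B * g n := by gcongr; exact le_mul_of_one_le_right (by linarith) hB
    have hAB : 0 < A * B := by positivity
    have h3 := Real.log_le_log hg0 h1
    have h4 := Real.log_le_log (Real.exp_pos _) h2
    rw [Real.log_mul hAB.ne' (Real.exp_pos _).ne', Real.log_exp] at h3
    rw [Real.log_mul hAB.ne' hg0.ne', Real.log_exp] at h4
    rw [abs_le]
    constructor <;> linarith
  refine tendsto_of_tendsto_of_tendsto_of_le_of_le' hlow hupp ?_ ?_ <;>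
    filter_upwards [eventually_ge_atTop 1] with n hn
  all_goals
    have hn' : (0 : ℝ) < n := Nat.cast_pos.2 hn
    have h := abs_le.1 (hbound n hn)
    have h5 : (n : ℝ) * (Real.log (A * B) / n) = Real.log (A * B) := mul_div_cancel₀ _ hn'.ne'
    have h6 : (n : ℝ) * (1 / (n : ℝ) * Real.log (g n)) = Real.log (g n) := by field_simp
    refine le_of_mul_le_mul_left ?_ hn'
    rw [h6]
  · rw [mul_sub, h5]; linarith [h.1]
  · rw [mul_add, h5]; linarith [h.2]

theorem ksEntropy_le (hf : IsContinuousSequence X f) (hbv : HasBoundedVariation X f)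
    {P A : ℝ} (hA : 1 ≤ A)
    (hP : ∀ n : ℕ, 1 ≤ n →
      weightSum f n ≤ A * Real.exp (n * P) ∧ Real.exp (n * P) ≤ A * weightSum f n)
    {μ : Measure (Pt X)} (hμ : μ ∈ invariantMeasures X) {L : ℝ}
    (hL : Tendsto (fun n : ℕ => 1 / (n : ℝ) * ∫ x, Real.log (f n x) ∂μ) atTop (𝓝 L)) :
    ksEntropy (shiftMap X) μ ≤ ((P - L : ℝ) : EReal) := by
  obtain ⟨M, hM, hMx⟩ := hbv.exists_weight_bound hf
  refine iSup_le fun r => iSup_le fun ξ => iSup_le fun hξ => ?_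
  refine EReal.le_of_forall_lt_iff_le.1 fun z hz => ?_
  have hz' : P - L < z := EReal.coe_lt_coe_iff.1 hz
  set δ := (z - (P - L)) / 2 with hδ
  obtain ⟨N, hN⟩ := exists_shannonEntropy_itinerary_le hf hM hMx hμ hξ (δ := δ)
    (by rw [hδ]; linarith)
  have hZ := tendsto_log_weightSum hf hA hP (g := weightSum f) le_rfl
    fun n _ => ⟨le_rfl, by rw [one_mul]⟩
  have hlim : Tendsto (fun n : ℕ => 1 / (n : ℝ) * Real.log (weightSum f (n + N)) +
      Real.log M / n - 1 / (n : ℝ) * ∫ x, Real.log (f (n + N) x) ∂μ + δ) atTop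
      (𝓝 (P + 0 - L + δ)) :=
    (((tendsto_div_shift hZ N).add (tendsto_const_div_atTop_nhds_zero_nat _)).sub
      (tendsto_div_shift (b := fun n => ∫ x, Real.log (f n x) ∂μ) hL N)).add_const δ
  have hev := hlim.eventually_le_const (u := z) (by rw [hδ]; linarith)
  refine limsup_le_of_le (by isBoundedDefault) ?_
  filter_upwards [hev, eventually_ge_atTop 1] with n hn hn1
  refine EReal.coe_le_coe_iff.2 (le_trans ?_ hn)
  have hn' : (0 : ℝ) < n := Nat.cast_pos.2 hn1
  refine (mul_le_mul_of_nonneg_left (hN n hn1) (by positivity)).trans (le_of_eq ?_)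
  field_simp

/-! ### The entropy of a Gibbs measure -/

theorem GibbsBound.le_ksEntropy (hf : IsContinuousSequence X f) (hbv : HasBoundedVariation X f)
    {μ : Measure (Pt X)} [IsProbabilityMeasure μ] {P C : ℝ} (hC : 1 ≤ C) (h : GibbsBound f P C μ)
    {L : ℝ}
    (hL : Tendsto (fun n : ℕ => 1 / (n : ℝ) * ∫ x, Real.log (f n x) ∂μ) atTop (𝓝 L)) :
    ((P - L : ℝ) : EReal) ≤ ksEntropy (shiftMap X) μ := by
  obtain ⟨M, hM, hMx⟩ := hbv.exists_weight_bound hf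
  let ξ : Pt X → Fin d := fun x => x.1 0
  have hξ : Measurable ξ := (measurable_pi_apply 0).comp measurable_subtype_coe
  have hit : ∀ n, itinerary (shiftMap X) ξ n = prefixWord n := fun n => by
    funext x i
    simp [itinerary, ξ, prefixWord, shiftMap_iterate_apply]
  refine le_trans ?_ (le_iSup_of_le d (le_iSup_of_le ξ (le_iSup_of_le hξ le_rfl)))
  have hH : ∀ n : ℕ, 1 ≤ n → n * P - Real.log (C * M) - ∫ x, Real.log (f n x) ∂μ ≤
      shannonEntropy μ (itinerary (shiftMap X) ξ n) := by
    intro n hn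
    rw [hit, shannonEntropy_eq_integral (measurable_prefixWord n)]
    have hconst : n * P - Real.log (C * M) = ∫ _, (n * P - Real.log (C * M)) ∂μ := by simp
    rw [hconst, ← integral_sub (integrable_const _) (hf.integrable_log μ hn)]
    refine integral_mono ((integrable_const _).sub (hf.integrable_log μ hn))
      (integrable_comp_of_finite (measurable_prefixWord n)
        fun w => -Real.log (μ.real (prefixWord n ⁻¹' {w}))) fun x => ?_
    have h1 := h n hn _ (prefixWord_mem_words n x)
    rw [cyl_eq_preimage] at h1
    have hfx := (hf n hn).2 x
    have h2 : μ.real (prefixWord n ⁻¹' {prefixWord n x}) ≤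
        C * M * (Real.exp (-(n * P)) * f n x) := by
      calc _ ≤ C * (Real.exp (-(n * P)) * (M * f n x)) :=
            h1.1.trans (by gcongr; exact (hMx n hn x).2)
        _ = _ := by ring
    have h3 : 0 < μ.real (prefixWord n ⁻¹' {prefixWord n x}) :=
      pos_of_mul_pos_right ((mul_pos (Real.exp_pos _) (hf.weight_pos hn _)).trans_le h1.2)
        (by linarith)
    have h4 := Real.log_le_log h3 h2
    rw [Real.log_mul (by positivity) (by positivity), Real.log_mul (Real.exp_pos _).ne' hfx.ne',
      Real.log_exp] at h4
    simp only
    linarith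
  have hlim : Tendsto (fun n : ℕ => P - Real.log (C * M) / n -
      1 / (n : ℝ) * ∫ x, Real.log (f n x) ∂μ) atTop (𝓝 (P - 0 - L)) :=
    (tendsto_const_nhds.sub (tendsto_const_div_atTop_nhds_zero_nat _)).sub hL
  rw [sub_zero] at hlim
  have hlim' := (EReal.tendsto_coe.2 hlim).limsup_eq
  rw [← hlim']
  refine limsup_le_limsup ?_ (by isBoundedDefault) (by isBoundedDefault)
  filter_upwards [eventually_ge_atTop 1] with n hn1
  refine EReal.coe_le_coe_iff.2 ?_
  have hn' : (0 : ℝ) < n := Nat.cast_pos.2 hn1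
  refine le_trans (le_of_eq ?_) (mul_le_mul_of_nonneg_left (hH n hn1) (by positivity))
  field_simp

/-! ### Pressure and the variational principle -/

theorem weightSum_le_partitionSum (hf : IsContinuousSequence X f) {M : ℝ} {n : ℕ} (hn : 1 ≤ n)
    (hM : ∀ x : Pt X, f n x ≤ M * weight f (prefixWord n x) ∧
      weight f (prefixWord n x) ≤ M * f n x) :
    weightSum f n ≤ partitionSum X f n ∧ partitionSum X f n ≤ M * weightSum f n := by
  rw [weightSum, Finset.mul_sum]
  refine ⟨Finset.sum_le_sum fun u hu => ?_, Finset.sum_le_sum fun u hu => ?_⟩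
  · exact le_csSup (hf.bddAbove hn _) ⟨_, representative_mem hu, rfl⟩
  · refine csSup_le ⟨_, _, representative_mem hu, rfl⟩ ?_
    rintro _ ⟨x, hx, rfl⟩
    exact mem_cyl_iff.1 hx ▸ (hM x).1

theorem pressure_eq (hf : IsContinuousSequence X f) (hbv : HasBoundedVariation X f)
    {P A : ℝ} (hA : 1 ≤ A)
    (hP : ∀ n : ℕ, 1 ≤ n →
      weightSum f n ≤ A * Real.exp (n * P) ∧ Real.exp (n * P) ≤ A * weightSum f n) :
    pressure X f = (P : EReal) := by
  obtain ⟨M, hM, hMx⟩ := hbv.exists_weight_bound hf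
  exact (EReal.tendsto_coe.2 (tendsto_log_weightSum hf hA hP hM
    fun n hn => weightSum_le_partitionSum hf hn (hMx n hn))).limsup_eq

/-- Existence of the asymptotic averages, the variational principle, and the equilibrium property
of the ergodic Gibbs measure. -/
theorem Balanced.variational (hf : IsContinuousSequence X f) (hsup : IsSuperadditive X f)
    (hk : HasStrongSpecification X k) (h : Balanced X f) :
    (∀ μ ∈ invariantMeasures X, ∃ L : ℝ, HasAsymptoticAverage X f μ (L : EReal)) ∧
      pressure X f = sSup (freeEnergies X f) ∧
      ∀ μ : Measure (Pt X), IsErgodicGibbs X f μ → IsEquilibriumState X f μ := by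
  have hbv := ((rightBalanced_iff hf).1 h.1).1
  obtain ⟨μ₀, hμ₀, -⟩ := h.existsUnique hf hsup hk
  obtain ⟨P, A, hA, hP⟩ := (h.1.sumBalanced hf hsup hk).exists_exp_bound hf
  have havg := fun (μ : Measure (Pt X)) (hμ : μ ∈ invariantMeasures X) =>
    exists_tendsto_average hf hsup hbv (fun n hn => (hP n hn).1) hμ
  have hle : ∀ e ∈ freeEnergies X f, e ≤ (P : EReal) := by
    rintro e ⟨μ, hμ, L', hL', rfl⟩
    obtain ⟨L, hL⟩ := havg μ hμ
    obtain rfl : L' = (L : EReal) := tendsto_nhds_unique hL' (EReal.tendsto_coe.2 hL)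
    calc ksEntropy (shiftMap X) μ + (L : EReal) ≤ ((P - L : ℝ) : EReal) + (L : EReal) := by
          gcongr
          exact ksEntropy_le hf hbv hA hP hμ hL
      _ = (P : EReal) := by rw [← EReal.coe_add, sub_add_cancel]
  have hgibbs : ∀ μ : Measure (Pt X), IsErgodicGibbs X f μ → μ ∈ invariantMeasures X ∧
      ∃ L : EReal, HasAsymptoticAverage X f μ L ∧
        ksEntropy (shiftMap X) μ + L = (P : EReal) := by
    intro μ hμ
    have hprob := hμ.1.1
    have hinv : μ ∈ invariantMeasures X := ⟨hprob, hμ.2.toMeasurePreserving⟩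
    obtain ⟨L, hL⟩ := havg μ hinv
    refine ⟨hinv, L, EReal.tendsto_coe.2 hL, le_antisymm (hle _ ⟨μ, hinv, L,
      EReal.tendsto_coe.2 hL, rfl⟩) ?_⟩
    obtain ⟨-, Q, C, hC, hQ⟩ := hμ.1.exists_gibbsBound hf
    -- The exponent of the Gibbs measure is the growth rate of `weightSum`, as both are limits of
    -- the same sequence.
    have hQP : Q = P := by
      refine tendsto_nhds_unique (tendsto_log_weightSum hf hC (fun n hn => ?_)
        (g := weightSum f) le_rfl fun n _ => ⟨le_rfl, by rw [one_mul]⟩)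
        (tendsto_log_weightSum hf hA hP (g := weightSum f) le_rfl
          fun n _ => ⟨le_rfl, by rw [one_mul]⟩)
      have h1 := hQ.weightSum_bound hn
      rw [Real.exp_neg, inv_mul_eq_div, mul_div_assoc', le_div_iff₀ (Real.exp_pos _), one_mul,
        div_le_iff₀ (Real.exp_pos _)] at h1
      exact h1.symm
    subst hQP
    calc (Q : EReal) = ((Q - L : ℝ) : EReal) + (L : EReal) := by
          rw [← EReal.coe_add, sub_add_cancel]
      _ ≤ _ := by
        gcongr
        exact hQ.le_ksEntropy hf hbv hC hL
  have hsSup : sSup (freeEnergies X f) = (P : EReal) := by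
    refine le_antisymm (sSup_le hle) ?_
    obtain ⟨hinv, L, hL, hP'⟩ := hgibbs μ₀ hμ₀
    exact le_sSup ⟨μ₀, hinv, L, hL, hP'.symm⟩
  refine ⟨fun μ hμ => (havg μ hμ).imp fun L hL => EReal.tendsto_coe.2 hL,
    (pressure_eq hf hbv hA hP).trans hsSup.symm, fun μ hμ => ?_⟩
  obtain ⟨hinv, L, hL, hP'⟩ := hgibbs μ hμ
  exact ⟨hinv, L, hL, hP'.trans hsSup.symm⟩

end

end ShiftGibbs

end

theorem theorem3p3 {d : ℕ} (X : ShiftGibbs.OneSidedSubshift d) (hX : X.carrier.Nonempty)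
    (f : ℕ → ShiftGibbs.Pt X → ℝ) (hf : ShiftGibbs.IsContinuousSequence X f)
    (hsup : ShiftGibbs.IsSuperadditive X f)
    (k : ℕ) (hk : ShiftGibbs.HasStrongSpecification X k) :
    (ShiftGibbs.RightBalanced X f ↔
      ShiftGibbs.HasBoundedVariation X f ∧ ShiftGibbs.RightUpperInequality X f k) ∧
    (ShiftGibbs.LeftBalanced X f ↔
      ShiftGibbs.HasBoundedVariation X f ∧ ShiftGibbs.LeftUpperInequality X f k) ∧
    (ShiftGibbs.Balanced X f ↔
      ShiftGibbs.HasBoundedVariation X f ∧ ShiftGibbs.RightUpperInequality X f k ∧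
        ShiftGibbs.LeftUpperInequality X f k) ∧
    (ShiftGibbs.Balanced X f ↔
      ∃! μ : Measure (ShiftGibbs.Pt X), ShiftGibbs.IsErgodicGibbs X f μ) ∧
    (ShiftGibbs.Balanced X f →
      (∀ μ ∈ ShiftGibbs.invariantMeasures X,
        ∃ L : ℝ, ShiftGibbs.HasAsymptoticAverage X f μ (L : EReal)) ∧
      ShiftGibbs.pressure X f = sSup (ShiftGibbs.freeEnergies X f) ∧
      ∀ μ : Measure (ShiftGibbs.Pt X), ShiftGibbs.IsErgodicGibbs X f μ →
        ShiftGibbs.IsEquilibriumState X f μ) := by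
  have : Nonempty (ShiftGibbs.Pt X) := hX.to_subtype
  refine ⟨ShiftGibbs.rightBalanced_iff_upper hf hsup hk,
    ShiftGibbs.leftBalanced_iff_upper hf hsup hk, ?_,
    ⟨fun h => h.existsUnique hf hsup hk, fun ⟨_, hμ, _⟩ => hμ.balanced hf⟩,
    fun h => h.variational hf hsup hk⟩
  rw [ShiftGibbs.Balanced, ShiftGibbs.rightBalanced_iff_upper hf hsup hk,
    ShiftGibbs.leftBalanced_iff_upper hf hsup hk]
  tauto
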